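/- Let $F$ be a field of characteristic $0$ (of numbers, or of rational functions in the parameters below taken as indeterminates), let $\beta,\gamma\in F$ be nonzero, let $G(z)=1+\sum_{k=1}^M g_kz^k$ be a polynomial over $F$ of degree exactly $M\ge 2$, let $s_1,\dots,s_L\in F$ with $L\ge 1$ and $s_L\neq 0$, and put $$\xi(z)=\sum_{k=1}^L s_kz^k,\qquad S(z)=\sum_{k=1}^L k s_kz^k .$$ Let $\sum_{j\ge0}h_j(\pm\beta^{-1}\mathbf s)z^j=e^{\pm\beta^{-1}\xi(z)}$ and $$\rho_j=\gamma^j\prod_{i=1}^jG(i\beta)\ (j\ge0),\qquad \rho_{-j}=\gamma^{-j}\prod_{i=0}^{j-1}G(-i\beta)^{-1},\quad \rho_{-j}^{-1}=\gamma^{j}\prod_{i=0}^{j-1}G(-i\beta)\ (j\ge1).$$ For $0\le k\le LM-1$ define the formal series in $x$ (only $\rho_n$ with $n\ge -1$ and the products $\rho_{-n}^{-1}$ with $n\ge0$ occur) $$\Psi^+_k(x)=\gamma\sum_{j\ge0}\rho_{j+k-1}\,h_j(\beta^{-1}\mathbf s)\,x^{j+k},\qquad \Psi^-_k(x)=\sum_{j\ge0}\rho_{-j-k}^{-1}\,h_j(-\beta^{-1}\mathbf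 s)\,x^{j+k},$$ and the vectors $\vec\Psi^\pm=(\Psi^\pm_0,\dots,\Psi^\pm_{LM-1})^T$. Let $D=x\frac{d}{dx}$. On rational functions of $r,t$ let $$\Delta_+(r)=S(r)+\beta r\tfrac{\partial}{\partial r},\quad \Delta_-(t)=S(t)-\beta t\tfrac{\partial}{\partial t},\quad V_+(r)=G(\Delta_+(r)),\quad V_-(t)=G(\Delta_-(t)).$$ Then the following hold. 1. The function $\left(rV_-(t)-tV_+(r)\right)\left(\frac1{r-t}\right)$ is a polynomial of degree at most $LM-1$ in each of $r$ and $t$. Hence an $LM\times LM$ matrix $\mathbf A=(A_{ij})$ over $F$ (the Christoffel–Darboux matrix) is defined by $$\sum_{i,j=0}^{LM-1}A_{ij}r^it^j=\left(rV_-(t)-tV_+(r)\right)\left(\frac1{r-t}\right),$$ and $\mathbf A$ is invertible. 2. A matrix $\tilde{\mathbf E}(x)$ is likewise well defined by $$\sum_{i,j=0}^{LM-1}\tilde{\mathbf E}(x)_{ij}r^it^j=\left(\Delta_+(r)\,r\,V_-(t)-\Delta_-(t)\,t\,V_+(r)\right)\left(\frac1{r-t}\right)-\frac1{\gamma x}\,rt\,\frac{S(r)-S(t)}{r-t}.$$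 The matrices $\tilde{\mathbf E}(x)$, $\mathbf E^-(x):=\mathbf A^{-1}\tilde{\mathbf E}(x)$ and $\mathbf E^+(x):=(\mathbf A^T)^{-1}\tilde{\mathbf E}(x)^T$ are polynomials of degree exactly one in $1/x$, with coefficients that are $LM\times LM$ matrices over $F$. 3. The vectors $\vec\Psi^\pm$ satisfy the linear differential systems $$\pm\beta D\,\vec\Psi^\pm(x)=\mathbf E^\pm(x)\,\vec\Psi^\pm(x).$$ -/

import Mathlib

open Polynomial

namespace WeightedHurwitz

noncomputable section

/-! ### Extension of derivations to the fraction field -/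

/-- The quotient rule `d (p / q) = (d p * q - p * d q) / q ^ 2` on a chosen representative. -/
def fracDerivFun {F R : Type*} [Field F] [CommRing R] [IsDomain R] [Algebra F R]
    (d : Derivation F R R) (f : FractionRing R) : FractionRing R :=
  (algebraMap R (FractionRing R) (d (IsLocalization.sec (nonZeroDivisors R) f).1
        * (IsLocalization.sec (nonZeroDivisors R) f).2
      - (IsLocalization.sec (nonZeroDivisors R) f).1
        * d (IsLocalization.sec (nonZeroDivisors R) f).2))
    / algebraMap R (FractionRing R) (IsLocalization.sec (nonZeroDivisors R) f).2 ^ 2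

/-- The quotient rule holds for every representation of a fraction. -/
theorem fracDerivFun_div {F R : Type*} [Field F] [CommRing R] [IsDomain R] [Algebra F R]
    (d : Derivation F R R) (a b : R) (hb : b ≠ 0) :
    fracDerivFun d (algebraMap R (FractionRing R) a / algebraMap R (FractionRing R) b)
      = algebraMap R (FractionRing R) (d a * b - a * d b)
        / algebraMap R (FractionRing R) b ^ 2 := by
  have inj : Function.Injective (algebraMap R (FractionRing R)) :=
    IsFractionRing.injective R (FractionRing R)
  have nz : ∀ c : R, c ≠ 0 → algebraMap R (FractionRing R) c ≠ 0 := fun c hc h =>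
    hc (inj (by rw [h, map_zero]))
  have hsec := IsLocalization.sec_spec' (nonZeroDivisors R)
    (algebraMap R (FractionRing R) a / algebraMap R (FractionRing R) b)
  unfold fracDerivFun
  generalize IsLocalization.sec (nonZeroDivisors R)
    (algebraMap R (FractionRing R) a / algebraMap R (FractionRing R) b) = pq at hsec ⊢
  obtain ⟨p, q, hq⟩ := pq
  have hq0 : q ≠ 0 := nonZeroDivisors.ne_zero hq
  have hb' := nz b hb
  have hq' := nz q hq0
  simp only at hsec ⊢
  have h1 : p * b = q * a := by
    apply inj
    rw [map_mul, map_mul, hsec]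
    field_simp
  have h2 : d (p * b) = d (q * a) := by rw [h1]
  simp only [Derivation.leibniz, smul_eq_mul] at h2
  rw [div_eq_div_iff (pow_ne_zero 2 hq') (pow_ne_zero 2 hb'), ← map_pow, ← map_pow,
    ← map_mul, ← map_mul]
  congr 1
  linear_combination (b * q) * h2 - (b * d q + q * d b) * h1

/-- The unique extension of a derivation of an integral domain to its fraction field. -/
def fracDeriv {F R : Type*} [Field F] [CommRing R] [IsDomain R] [Algebra F R]
    (d : Derivation F R R) : Derivation F (FractionRing R) (FractionRing R) :=
  have nz : ∀ c : R, c ≠ 0 → algebraMap R (FractionRing R) c ≠ 0 := fun c hc h =>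
    hc (IsFractionRing.injective R (FractionRing R) (by rw [h, map_zero]))
  Derivation.mk'
    { toFun := fracDerivFun d
      map_add' := by
        intro f g
        obtain ⟨a, b, hb, rfl⟩ := IsFractionRing.div_surjective (A := R) f
        obtain ⟨a', b', hb', rfl⟩ := IsFractionRing.div_surjective (A := R) g
        have hb0 : b ≠ 0 := nonZeroDivisors.ne_zero hb
        have hb0' : b' ≠ 0 := nonZeroDivisors.ne_zero hb'
        have h1 := nz b hb0
        have h2 := nz b' hb0'
        rw [div_add_div _ _ h1 h2, ← map_mul, ← map_mul, ← map_mul, ← map_add,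
          fracDerivFun_div d _ _ (mul_ne_zero hb0 hb0'), fracDerivFun_div d _ _ hb0,
          fracDerivFun_div d _ _ hb0']
        simp only [Derivation.leibniz, map_add, map_sub, map_mul, smul_eq_mul]
        field_simp
        ring
      map_smul' := by
        intro c f
        obtain ⟨a, b, hb, rfl⟩ := IsFractionRing.div_surjective (A := R) f
        have hb0 : b ≠ 0 := nonZeroDivisors.ne_zero hb
        have h : c • (algebraMap R (FractionRing R) a / algebraMap R (FractionRing R) b)
            = algebraMap R (FractionRing R) (c • a) / algebraMap R (FractionRing R) b := by
          rw [Algebra.smul_def, Algebra.smul_def, map_mul, mul_div_assoc,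
            IsScalarTower.algebraMap_apply F R (FractionRing R)]
        rw [h, fracDerivFun_div d _ _ hb0, fracDerivFun_div d _ _ hb0, RingHom.id_apply,
          Algebra.smul_def c (_ / _), IsScalarTower.algebraMap_apply F R (FractionRing R),
          ← mul_div_assoc, ← map_mul, ← Algebra.smul_def, d.map_smul, smul_sub,
          smul_mul_assoc, smul_mul_assoc] }
    (by
      intro f g
      change fracDerivFun d (f * g) = f • fracDerivFun d g + g • fracDerivFun d f
      obtain ⟨a, b, hb, rfl⟩ := IsFractionRing.div_surjective (A := R) f
      obtain ⟨a', b', hb', rfl⟩ := IsFractionRing.div_surjective (A := R) g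
      have hb0 : b ≠ 0 := nonZeroDivisors.ne_zero hb
      have hb0' : b' ≠ 0 := nonZeroDivisors.ne_zero hb'
      have h1 := nz b hb0
      have h2 := nz b' hb0'
      rw [div_mul_div_comm, ← map_mul, ← map_mul,
        fracDerivFun_div d _ _ (mul_ne_zero hb0 hb0'), fracDerivFun_div d _ _ hb0,
        fracDerivFun_div d _ _ hb0']
      simp only [Derivation.leibniz, map_add, map_sub, map_mul, smul_eq_mul]
      field_simp
      ring)

/-! ### The adapted bases -/

/-- The series `exp (a * ξ(x, s))`, where `ξ(x, s) = s 1 * x + ⋯ + s L * x ^ L`. -/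
def expXi {F : Type*} [Field F] [CharZero F] (L : ℕ) (s : ℕ → F) (a : F) : PowerSeries F :=
  (PowerSeries.exp F).subst
    (∑ k ∈ Finset.Icc 1 L, PowerSeries.C (a * s k) * PowerSeries.X ^ k)

/-- The complete symmetric function `h_j (a s)`, in terms of the flow variables `s`:
`∑ j, h_j (a s) * x ^ j = exp (a * ξ(x, s))`. -/
def hSym {F : Type*} [Field F] [CharZero F] (L : ℕ) (s : ℕ → F) (a : F) (j : ℕ) : F :=
  PowerSeries.coeff j (expXi L s a)

/-- The coefficients `ρ_j = γ ^ j * ∏_{i = 1}^{j} G(i β)` and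
`ρ_{-j} = γ ^ (-j) * ∏_{i = 0}^{j - 1} G(-i β)⁻¹`. -/
def rho {F : Type*} [Field F] (G : F[X]) (β γ : F) : ℤ → F
  | Int.ofNat j => γ ^ j * ∏ i ∈ Finset.Icc 1 j, G.eval ((i : F) * β)
  | Int.negSucc n => (γ ^ (n + 1))⁻¹ * ∏ i ∈ Finset.range (n + 1), (G.eval (-(i : F) * β))⁻¹

/-- The formal Laurent series `∑_{n ≥ k} a_n * x ^ n`. -/
def seriesFrom {F : Type*} [Field F] (k : ℤ) (a : ℤ → F) : LaurentSeries F :=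
  HahnSeries.ofSuppBddBelow (fun n => if k ≤ n then a n else 0)
    ⟨k, fun n hn => by
      by_contra h
      exact hn (if_neg h)⟩

/-- `Ψ⁺_k(x) = γ * ∑_{n ≥ k} ρ_{n-1} * h_{n-k}(β⁻¹ s) * x ^ n`. -/
def PsiPlus {F : Type*} [Field F] [CharZero F] (L : ℕ) (G : F[X]) (s : ℕ → F) (β γ : F)
    (k : ℤ) : LaurentSeries F :=
  seriesFrom k fun n => γ * rho G β γ (n - 1) * hSym L s β⁻¹ (n - k).toNat

/-- `Ψ⁻_k(x) = ∑_{n ≥ k} ρ_{-n}⁻¹ * h_{n-k}(-β⁻¹ s) * x ^ n`. -/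
def PsiMinus {F : Type*} [Field F] [CharZero F] (L : ℕ) (G : F[X]) (s : ℕ → F) (β γ : F)
    (k : ℤ) : LaurentSeries F :=
  seriesFrom k fun n => (rho G β γ (-n))⁻¹ * hSym L s (-β⁻¹) (n - k).toNat

/-- The Euler operator `D = x d/dx` on formal Laurent series in `x`. -/
def eulerD {F : Type*} [Field F] (f : LaurentSeries F) : LaurentSeries F :=
  HahnSeries.single 1 1 * LaurentSeries.derivative F f

/-! ### The Christoffel-Darboux matrix and the folded matrices -/

/-- The field of rational functions in two variables `r`, `t`. -/
abbrev RatRT (F : Type*) [Field F] : Type _ := FractionRing (MvPolynomial (Fin 2) F)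

/-- The variable `r`. -/
def rVar (F : Type*) [Field F] : RatRT F := algebraMap _ _ (MvPolynomial.X 0 : MvPolynomial (Fin 2) F)

/-- The variable `t`. -/
def tVar (F : Type*) [Field F] : RatRT F := algebraMap _ _ (MvPolynomial.X 1 : MvPolynomial (Fin 2) F)

/-- The Euler operator in the `i`-th of the variables `r`, `t`, on rational functions. -/
def eulerRT (F : Type*) [Field F] (i : Fin 2) : Derivation F (RatRT F) (RatRT F) :=
  fracDeriv ((MvPolynomial.X i : MvPolynomial (Fin 2) F) • MvPolynomial.pderiv i)

/-- `S(z) = ∑_{k = 1}^{L} k * s k * z ^ k`. -/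
def SPoly {F : Type*} [Field F] (L : ℕ) (s : ℕ → F) : F[X] :=
  ∑ k ∈ Finset.Icc 1 L, C ((k : F) * s k) * X ^ k

/-- `Δ₊(r) = S(r) + β r d/dr`. -/
def deltaPlus {F : Type*} [Field F] (L : ℕ) (s : ℕ → F) (β : F) : Module.End F (RatRT F) :=
  LinearMap.mulLeft F (aeval (rVar F) (SPoly L s)) + β • (eulerRT F 0 : RatRT F →ₗ[F] RatRT F)

/-- `Δ₋(t) = S(t) - β t d/dt`. -/
def deltaMinus {F : Type*} [Field F] (L : ℕ) (s : ℕ → F) (β : F) : Module.End F (RatRT F) :=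
  LinearMap.mulLeft F (aeval (tVar F) (SPoly L s)) - β • (eulerRT F 1 : RatRT F →ₗ[F] RatRT F)

/-- `V₊(r) = G(Δ₊(r))`. -/
def VPlus {F : Type*} [Field F] (L : ℕ) (G : F[X]) (s : ℕ → F) (β : F) :
    Module.End F (RatRT F) :=
  aeval (deltaPlus L s β) G

/-- `V₋(t) = G(Δ₋(t))`. -/
def VMinus {F : Type*} [Field F] (L : ℕ) (G : F[X]) (s : ℕ → F) (β : F) :
    Module.End F (RatRT F) :=
  aeval (deltaMinus L s β) G

/-- `A(r, t) = (r V₋(t) - t V₊(r)) (1 / (r - t))`. -/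
def AGen {F : Type*} [Field F] (L : ℕ) (G : F[X]) (s : ℕ → F) (β : F) : RatRT F :=
  rVar F * VMinus L G s β (1 / (rVar F - tVar F))
    - tVar F * VPlus L G s β (1 / (rVar F - tVar F))

/-- `(Δ₊(r) r V₋(t) - Δ₋(t) t V₊(r)) (1 / (r - t))`. -/
def CGen {F : Type*} [Field F] (L : ℕ) (G : F[X]) (s : ℕ → F) (β : F) : RatRT F :=
  deltaPlus L s β (rVar F * VMinus L G s β (1 / (rVar F - tVar F)))
    - deltaMinus L s β (tVar F * VPlus L G s β (1 / (rVar F - tVar F)))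

/-- `r t (S(r) - S(t)) / (r - t)`. -/
def BGen {F : Type*} [Field F] (L : ℕ) (s : ℕ → F) : RatRT F :=
  rVar F * tVar F * (aeval (rVar F) (SPoly L s) - aeval (tVar F) (SPoly L s))
    / (rVar F - tVar F)

/-- The generating function
`(Δ₊(r) r V₋(t) - Δ₋(t) t V₊(r)) (1 / (r - t)) - (γ x)⁻¹ r t (S(r) - S(t)) / (r - t)`
of the matrix `Ẽ(x)`, a Laurent polynomial in `x` over the rational functions of `r`, `t`. -/
def EGen {F : Type*} [Field F] (L : ℕ) (G : F[X]) (s : ℕ → F) (β γ : F) :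
    LaurentSeries (RatRT F) :=
  HahnSeries.C (CGen L G s β) - HahnSeries.single (-1) (γ⁻¹ • BGen L s)

open Classical in
/-- The coefficient of `r ^ i * t ^ j` in a rational function that is a polynomial in `r`, `t`
(and `0` for the other rational functions). -/
def coeffRT {F : Type*} [Field F] (f : RatRT F) (i j : ℕ) : F :=
  if h : ∃ p : MvPolynomial (Fin 2) F, algebraMap _ (RatRT F) p = f then
    MvPolynomial.coeff (Finsupp.single 0 i + Finsupp.single 1 j) h.choose
  else 0

/-- The Christoffel-Darboux matrix `A = (A_{ij})`, `0 ≤ i, j < n`. -/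
def AMat {F : Type*} [Field F] (n L : ℕ) (G : F[X]) (s : ℕ → F) (β : F) :
    Matrix (Fin n) (Fin n) F :=
  Matrix.of fun i j => coeffRT (AGen L G s β) i j

/-- The matrix `Ẽ(x)`, with entries in the Laurent series in `x`. -/
def ETilde {F : Type*} [Field F] (n L : ℕ) (G : F[X]) (s : ℕ → F) (β γ : F) :
    Matrix (Fin n) (Fin n) (LaurentSeries F) :=
  Matrix.of fun i j => HahnSeries.C (coeffRT (CGen L G s β) i j)
    - HahnSeries.single (-1) (γ⁻¹ * coeffRT (BGen L s) i j)

/-- `E⁺(x) = (Aᵀ)⁻¹ Ẽ(x)ᵀ`. -/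
def EPlus {F : Type*} [Field F] (n L : ℕ) (G : F[X]) (s : ℕ → F) (β γ : F) :
    Matrix (Fin n) (Fin n) (LaurentSeries F) :=
  ((AMat n L G s β).transpose⁻¹).map (fun a => HahnSeries.C a) * (ETilde n L G s β γ).transpose

/-- `E⁻(x) = A⁻¹ Ẽ(x)`. -/
def EMinus {F : Type*} [Field F] (n L : ℕ) (G : F[X]) (s : ℕ → F) (β γ : F) :
    Matrix (Fin n) (Fin n) (LaurentSeries F) :=
  ((AMat n L G s β)⁻¹).map (fun a => HahnSeries.C a) * ETilde n L G s β γ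

/-- The matrix is a polynomial in `1 / x` of degree exactly one. -/
def IsDegreeOneInInverse {F : Type*} [Field F] {n : ℕ}
    (E : Matrix (Fin n) (Fin n) (LaurentSeries F)) : Prop :=
  ∃ E₀ E₁ : Matrix (Fin n) (Fin n) F, E₁ ≠ 0 ∧
    E = E₀.map (fun a => HahnSeries.C a) + E₁.map (fun a => HahnSeries.single (-1) a)

end

end WeightedHurwitz

namespace WeightedHurwitz

noncomputable section

/-! ### Weight filtrations of the polynomials in `r`, `t` -/

/-! Write u = 1/(r - t), and let σ = (S(r) - S(t))/(r - t), a polynomial. The function t u is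
homogeneous of degree 0, so r∂_r + t∂_t kills it and (Δ₊ - Δ₋)(t u) = t σ. Similarly (Δ₊ - Δ₋)(r u)
= r σ. Since Δ₊(r) and Δ₋(t) commute, this yields polynomial recursions for Δ₋^m(r u) - Δ₊^m(t u),
one driven by Δ₋ and one by Δ₊ (`cdMonomial_succ`, `cdMonomial_succ'`). Δ₋ does not raise the degree
in r, nor Δ₊ the degree in t, so the two forms together bound both partial degrees. The same
identity writes the generating function of the folded matrix in two ways, Δ₊A + V₊(t σ) = Δ₋A + V₋(r
σ) (`foldPoly`, `foldPoly_eq'`).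

Invertibility: A(0, t) = G(0) = 1, so the first row is a unit vector. A has total degree at most LM,
and its entries with i + j = LM all equal -g_M (L s_L)^M, which is nonzero (`coeffXY_cdPoly_of_eq`).
Such a matrix is antitriangular apart from its first row.

Differential systems: let a linear functional send r^k to Ψ⁺_k. The logarithmic derivative of the
exponential turns Δ₊(r) into βD (`eulerEnd_adapted`), and the recursion for ρ turns multiplication
by r into γ x G(βD) (`adapted_succ`). Applied to Δ₊A + V₊(t σ), the functional turns the second term
into (γx)⁻¹ times the image of r t σ, which is exactly the term subtracted in Ẽ(x)
(`eulerEnd_pairing`). The system for Ψ⁻ arises in the same way from t, -β and the other form of the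
folded polynomial. -/

/-- The polynomials all of whose monomials have weight less than `n`. -/
def weightLT (F : Type*) [Field F] (f : (Fin 2 →₀ ℕ) →+ ℕ) (n : ℕ) :
    Submodule F (MvPolynomial (Fin 2) F) where
  carrier := {p | ∀ m, n ≤ f m → MvPolynomial.coeff m p = 0}
  add_mem' hp hq m hm := by rw [MvPolynomial.coeff_add, hp m hm, hq m hm, add_zero]
  zero_mem' m _ := MvPolynomial.coeff_zero m
  smul_mem' c p hp m hm := by rw [MvPolynomial.coeff_smul, hp m hm, smul_zero]

section Filtration

variable {F : Type*} [Field F] {f : (Fin 2 →₀ ℕ) →+ ℕ} {p q : MvPolynomial (Fin 2) F}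

theorem weightLT_mono {a b : ℕ} (h : a ≤ b) (hp : p ∈ weightLT F f a) : p ∈ weightLT F f b :=
  fun m hm => hp m (h.trans hm)

/-- The bounds are strict, so weights at most a and less than b add up to less than a + b. Writing
the first bound as a + 1 keeps the estimate sharp without subtraction. -/
theorem mul_mem_weightLT {a b : ℕ} (hp : p ∈ weightLT F f (a + 1)) (hq : q ∈ weightLT F f b) :
    p * q ∈ weightLT F f (a + b) := by
  intro m hm
  rw [MvPolynomial.coeff_mul]
  refine Finset.sum_eq_zero fun x hx => ?_
  have hx' : f x.1 + f x.2 = f m := by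
    rw [← map_add, Finset.HasAntidiagonal.mem_antidiagonal.mp hx]
  rcases le_or_gt (a + 1) (f x.1) with h | h
  · rw [hp _ h, zero_mul]
  · rw [hq _ (by omega), mul_zero]

theorem C_mem_weightLT (c : F) : MvPolynomial.C c ∈ weightLT F f 1 := by
  classical
  intro m hm
  rw [MvPolynomial.coeff_C, if_neg]
  rintro rfl
  simp at hm

theorem one_mem_weightLT : (1 : MvPolynomial (Fin 2) F) ∈ weightLT F f 1 := by
  simpa using C_mem_weightLT (f := f) (1 : F)

theorem X_pow_mem_weightLT (i : Fin 2) (k : ℕ) :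
    (MvPolynomial.X i : MvPolynomial (Fin 2) F) ^ k ∈
      weightLT F f (k * f (Finsupp.single i 1) + 1) := by
  classical
  intro m hm
  rw [MvPolynomial.coeff_X_pow, if_neg]
  rintro rfl
  rw [show Finsupp.single i k = k • Finsupp.single i 1 by simp, map_nsmul, smul_eq_mul] at hm
  omega

theorem X_mem_weightLT (i : Fin 2) :
    (MvPolynomial.X i : MvPolynomial (Fin 2) F) ∈ weightLT F f (f (Finsupp.single i 1) + 1) := by
  simpa using X_pow_mem_weightLT (F := F) (f := f) i 1

theorem C_mul_mem_weightLT (c : F) {n : ℕ} (hp : p ∈ weightLT F f n) :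
    MvPolynomial.C c * p ∈ weightLT F f n := by
  rw [MvPolynomial.C_mul']
  exact Submodule.smul_mem _ c hp

/-- Euler operators are diagonal on monomials; this is why they preserve every weight filtration and
commute with each other. -/
theorem coeff_X_mul_pderiv (i : Fin 2) (m : Fin 2 →₀ ℕ) :
    MvPolynomial.coeff m (MvPolynomial.X i * MvPolynomial.pderiv i p)
      = (m i : F) * MvPolynomial.coeff m p := by
  classical
  rw [mul_comm, MvPolynomial.coeff_mul_X', MvPolynomial.coeff_pderiv]
  split_ifs with h
  · have h1 : Finsupp.single i 1 ≤ m := by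
      simpa [Finsupp.single_le_iff, Nat.one_le_iff_ne_zero] using h
    rw [tsub_add_cancel_of_le h1, mul_comm]
    congr 1
    have h2 := Finsupp.single_le_iff.mp h1
    rw [Finsupp.tsub_apply, Finsupp.single_eq_same]
    push_cast [h2]
    ring
  · rw [Finsupp.notMem_support_iff.mp h]
    simp

theorem X_mul_pderiv_mem_weightLT (i : Fin 2) {n : ℕ} (hp : p ∈ weightLT F f n) :
    MvPolynomial.X i * MvPolynomial.pderiv i p ∈ weightLT F f n := by
  intro m hm
  rw [coeff_X_mul_pderiv, hp m hm, mul_zero]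

end Filtration

/-! ### The operators `S(z) + b z d/dz` on polynomials -/

/-- `S(X_i)`. -/
def SVar {F : Type*} [Field F] (L : ℕ) (s : ℕ → F) (i : Fin 2) : MvPolynomial (Fin 2) F :=
  aeval (MvPolynomial.X i) (SPoly L s)

/-- `S(X_i) + b X_i ∂/∂X_i`, on polynomials. -/
def delta {F : Type*} [Field F] (L : ℕ) (s : ℕ → F) (i : Fin 2) (b : F) :
    Module.End F (MvPolynomial (Fin 2) F) :=
  LinearMap.mulLeft F (SVar L s i)
    + b • (((MvPolynomial.X i : MvPolynomial (Fin 2) F) • MvPolynomial.pderiv i :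
        Derivation F (MvPolynomial (Fin 2) F) (MvPolynomial (Fin 2) F)) :
          MvPolynomial (Fin 2) F →ₗ[F] MvPolynomial (Fin 2) F)

/-- `(S(r) - S(t)) / (r - t)`. -/
def sigma {F : Type*} [Field F] (L : ℕ) (s : ℕ → F) : MvPolynomial (Fin 2) F :=
  ∑ k ∈ Finset.Icc 1 L, MvPolynomial.C ((k : F) * s k) *
    ∑ i ∈ Finset.range k, MvPolynomial.X 0 ^ i * MvPolynomial.X 1 ^ (k - 1 - i)

section Delta

variable {F : Type*} [Field F] (L : ℕ) (s : ℕ → F)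

theorem SVar_eq (i : Fin 2) :
    SVar L s i = ∑ k ∈ Finset.Icc 1 L, MvPolynomial.C ((k : F) * s k) * MvPolynomial.X i ^ k := by
  simp only [SVar, SPoly, map_sum, map_mul, map_pow, aeval_X, aeval_C, MvPolynomial.algebraMap_eq]

theorem delta_apply (i : Fin 2) (b : F) (p : MvPolynomial (Fin 2) F) :
    delta L s i b p = SVar L s i * p
      + MvPolynomial.C b * (MvPolynomial.X i * MvPolynomial.pderiv i p) := by
  simp [delta, MvPolynomial.C_mul']

theorem sigma_mul : sigma L s * (MvPolynomial.X 0 - MvPolynomial.X 1) = SVar L s 0 - SVar L s 1 := by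
  rw [sigma, Finset.sum_mul, SVar_eq, SVar_eq, ← Finset.sum_sub_distrib]
  refine Finset.sum_congr rfl fun k _ => ?_
  rw [mul_assoc, geom_sum₂_mul, mul_sub]

theorem SVar_mem_weightLT (f : (Fin 2 →₀ ℕ) →+ ℕ) (i : Fin 2) :
    SVar L s i ∈ weightLT F f (L * f (Finsupp.single i 1) + 1) := by
  rw [SVar_eq]
  refine Submodule.sum_mem _ fun k hk => C_mul_mem_weightLT _ ?_
  exact weightLT_mono (Nat.succ_le_succ (Nat.mul_le_mul_right _ (Finset.mem_Icc.mp hk).2))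
    (X_pow_mem_weightLT i k)

theorem sigma_mem_weightLT (f : (Fin 2 →₀ ℕ) →+ ℕ) (hf : ∀ i, f (Finsupp.single i 1) ≤ 1) :
    sigma L s ∈ weightLT F f L := by
  refine Submodule.sum_mem _ fun k hk => C_mul_mem_weightLT _ (Submodule.sum_mem _ fun i hi => ?_)
  have hk' := Finset.mem_Icc.mp hk
  have hi' := Finset.mem_range.mp hi
  refine weightLT_mono ?_ (mul_mem_weightLT (X_pow_mem_weightLT 0 i)
    (X_pow_mem_weightLT 1 (k - 1 - i)))
  have h0 := Nat.mul_le_mul_left i (hf 0)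
  have h1 := Nat.mul_le_mul_left (k - 1 - i) (hf 1)
  omega

theorem delta_mem_weightLT (f : (Fin 2 →₀ ℕ) →+ ℕ) (i : Fin 2) (b : F) {n : ℕ}
    {p : MvPolynomial (Fin 2) F} (hp : p ∈ weightLT F f n) :
    delta L s i b p ∈ weightLT F f (n + L * f (Finsupp.single i 1)) := by
  rw [delta_apply]
  refine Submodule.add_mem _ ?_ (C_mul_mem_weightLT _ ?_)
  · rw [add_comm n]
    exact mul_mem_weightLT (SVar_mem_weightLT L s f i) hp
  · exact weightLT_mono (Nat.le_add_right _ _) (X_mul_pderiv_mem_weightLT i hp)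

theorem delta_pow_mem_weightLT (f : (Fin 2 →₀ ℕ) →+ ℕ) (i : Fin 2) (b : F) {n : ℕ}
    {p : MvPolynomial (Fin 2) F} (hp : p ∈ weightLT F f n) (m : ℕ) :
    (delta L s i b ^ m) p ∈ weightLT F f (n + L * f (Finsupp.single i 1) * m) := by
  induction m with
  | zero => simpa using hp
  | succ m ih =>
    rw [pow_succ', Module.End.mul_apply, mul_add, mul_one, ← add_assoc]
    exact delta_mem_weightLT L s f i b ih

theorem pderiv_SVar {i j : Fin 2} (h : i ≠ j) : MvPolynomial.pderiv i (SVar L s j) = 0 := by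
  rw [SVar_eq, map_sum]
  refine Finset.sum_eq_zero fun k _ => ?_
  simp [Derivation.leibniz, Derivation.leibniz_pow, MvPolynomial.pderiv_X_of_ne h.symm]

theorem delta_commute {i j : Fin 2} (h : i ≠ j) (b c : F) :
    Commute (delta L s i b) (delta L s j c) := by
  refine LinearMap.ext fun p => ?_
  have hd : MvPolynomial.X i * MvPolynomial.pderiv i (MvPolynomial.X j * MvPolynomial.pderiv j p)
      = MvPolynomial.X j * MvPolynomial.pderiv j (MvPolynomial.X i * MvPolynomial.pderiv i p) := by
    ext m
    simp only [coeff_X_mul_pderiv]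
    ring
  simp only [Module.End.mul_apply, delta_apply, map_add, MvPolynomial.pderiv_C_mul,
    Derivation.leibniz _ (SVar L s _), pderiv_SVar L s h, pderiv_SVar L s h.symm, smul_eq_mul]
  linear_combination MvPolynomial.C c * MvPolynomial.C b * hd

theorem commute_delta_mulLeft_X {i j : Fin 2} (h : i ≠ j) (b : F) :
    Commute (delta L s i b) (LinearMap.mulLeft F (MvPolynomial.X j)) := by
  refine LinearMap.ext fun p => ?_
  simp only [Module.End.mul_apply, delta_apply, LinearMap.mulLeft_apply, Derivation.leibniz,
    MvPolynomial.pderiv_X_of_ne h.symm, smul_eq_mul]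
  ring

end Delta

/-! ### The Christoffel-Darboux polynomial -/

/-- The polynomial `(r Δ₋(t) ^ m - t Δ₊(r) ^ m) (1 / (r - t))`. -/
def cdMonomial {F : Type*} [Field F] (L : ℕ) (s : ℕ → F) (β : F) : ℕ → MvPolynomial (Fin 2) F
  | 0 => 1
  | m + 1 => delta L s 1 (-β) (cdMonomial L s β m)
      - (delta L s 0 β ^ m) (MvPolynomial.X 1 * sigma L s)

/-- The polynomial `(r V₋(t) - t V₊(r)) (1 / (r - t))`. -/
def cdPoly {F : Type*} [Field F] (L : ℕ) (G : F[X]) (s : ℕ → F) (β : F) :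
    MvPolynomial (Fin 2) F :=
  ∑ m ∈ Finset.range (G.natDegree + 1), G.coeff m • cdMonomial L s β m

/-- The polynomial `(Δ₊(r) r V₋(t) - Δ₋(t) t V₊(r)) (1 / (r - t))`. -/
def foldPoly {F : Type*} [Field F] (L : ℕ) (G : F[X]) (s : ℕ → F) (β : F) :
    MvPolynomial (Fin 2) F :=
  delta L s 0 β (cdPoly L G s β) + aeval (delta L s 0 β) G (MvPolynomial.X 1 * sigma L s)

section ChristoffelDarboux

variable {F : Type*} [Field F] (L : ℕ) (G : F[X]) (s : ℕ → F) (β : F)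

theorem aeval_end_apply {V : Type*} [AddCommGroup V] [Module F V] (T : Module.End F V) (v : V) :
    aeval T G v = ∑ m ∈ Finset.range (G.natDegree + 1), G.coeff m • (T ^ m) v := by
  rw [aeval_eq_sum_range, LinearMap.sum_apply]
  rfl

theorem cdMonomial_succ (m : ℕ) : cdMonomial L s β (m + 1) = delta L s 1 (-β) (cdMonomial L s β m)
    - (delta L s 0 β ^ m) (MvPolynomial.X 1 * sigma L s) :=
  rfl

/-- The recursion seen from the other variable. It starts from S(t) - t σ = S(r) - r σ and
propagates because the two operators commute. -/
theorem cdMonomial_succ' (m : ℕ) : cdMonomial L s β (m + 1) = delta L s 0 β (cdMonomial L s β m)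
    - (delta L s 1 (-β) ^ m) (MvPolynomial.X 0 * sigma L s) := by
  have comm (p) : delta L s 0 β (delta L s 1 (-β) p) = delta L s 1 (-β) (delta L s 0 β p) :=
    LinearMap.congr_fun (delta_commute L s (i := 0) (j := 1) (by decide) β (-β)) p
  induction m with
  | zero =>
    rw [cdMonomial_succ]
    simp only [cdMonomial, pow_zero, Module.End.one_apply, delta_apply,
      Derivation.map_one_eq_zero]
    linear_combination sigma_mul L s
  | succ m ih =>
    rw [cdMonomial_succ L s β (m + 1), ih, map_sub, ← comm, pow_succ', pow_succ',
      Module.End.mul_apply, Module.End.mul_apply, ← ih, cdMonomial_succ L s β m, map_sub]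
    abel

theorem delta_sub_cdMonomial (m : ℕ) :
    delta L s 0 β (cdMonomial L s β m)
        + (delta L s 0 β ^ m) (MvPolynomial.X 1 * sigma L s)
      = delta L s 1 (-β) (cdMonomial L s β m)
        + (delta L s 1 (-β) ^ m) (MvPolynomial.X 0 * sigma L s) := by
  have h := cdMonomial_succ' L s β m
  rw [cdMonomial_succ] at h
  linear_combination -h

theorem foldPoly_eq' : foldPoly L G s β = delta L s 1 (-β) (cdPoly L G s β)
    + aeval (delta L s 1 (-β)) G (MvPolynomial.X 0 * sigma L s) := by
  simp only [foldPoly, cdPoly, aeval_end_apply, map_sum, map_smul, ← Finset.sum_add_distrib,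
    ← smul_add, delta_sub_cdMonomial]

theorem X_mul_sigma_mem_weightLT (f : (Fin 2 →₀ ℕ) →+ ℕ) (hf : ∀ i, f (Finsupp.single i 1) ≤ 1)
    (i : Fin 2) : MvPolynomial.X i * sigma L s ∈ weightLT F f (f (Finsupp.single i 1) + L) :=
  mul_mem_weightLT (X_mem_weightLT i) (sigma_mem_weightLT L s f hf)

/-- The exponent of `X_i`. -/
def expo (i : Fin 2) : (Fin 2 →₀ ℕ) →+ ℕ :=
  Finsupp.applyAddHom i

theorem expo_apply (i : Fin 2) (m : Fin 2 →₀ ℕ) : expo i m = m i :=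
  rfl

theorem expo_single_le (i j : Fin 2) : expo i (Finsupp.single j 1) ≤ 1 := by
  rw [expo_apply, Finsupp.single_apply]
  split_ifs <;> simp

/-- For each variable, the recursion is chosen whose outer operator acts on the other variable: the
degree then grows only through the inhomogeneous term. The maximum with 1 accounts for m = 0, where
the polynomial is 1. -/
theorem cdMonomial_mem_weightLT (hL : 1 ≤ L) (i : Fin 2) (m : ℕ) :
    cdMonomial L s β m ∈ weightLT F (expo i) (max 1 (L * m)) := by
  induction m with
  | zero => exact weightLT_mono (le_max_left _ _) one_mem_weightLT
  | succ m ih =>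
    have key : max 1 (L * m) ≤ L * (m + 1) := max_le (by nlinarith) (by nlinarith)
    refine weightLT_mono (le_max_right _ _) ?_
    fin_cases i
    · rw [cdMonomial_succ]
      refine Submodule.sub_mem _ (weightLT_mono ?_ (delta_mem_weightLT L s _ 1 (-β) ih))
        (weightLT_mono ?_ (delta_pow_mem_weightLT L s _ 0 β
          (X_mul_sigma_mem_weightLT L s _ (expo_single_le _) 1) m))
      · simpa [expo_apply] using key
      · simp [expo_apply, mul_add, add_comm]
    · rw [cdMonomial_succ']
      refine Submodule.sub_mem _ (weightLT_mono ?_ (delta_mem_weightLT L s _ 0 β ih))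
        (weightLT_mono ?_ (delta_pow_mem_weightLT L s _ 1 (-β)
          (X_mul_sigma_mem_weightLT L s _ (expo_single_le _) 0) m))
      · simpa [expo_apply] using key
      · simp [expo_apply, mul_add, add_comm]

variable {G}

theorem cdPoly_mem_weightLT (hL : 1 ≤ L) (hG : 1 ≤ G.natDegree) (i : Fin 2) :
    cdPoly L G s β ∈ weightLT F (expo i) (L * G.natDegree) := by
  refine Submodule.sum_mem _ fun m hm => Submodule.smul_mem _ _ ?_
  have hm' : m ≤ G.natDegree := Nat.lt_succ_iff.mp (Finset.mem_range.mp hm)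
  exact weightLT_mono (max_le (by nlinarith) (Nat.mul_le_mul_left _ hm'))
    (cdMonomial_mem_weightLT L s β hL i m)

theorem aeval_delta_mem_weightLT {f : (Fin 2 →₀ ℕ) →+ ℕ} {i : Fin 2} (b : F)
    (hf : f (Finsupp.single i 1) = 0) {n : ℕ} {p : MvPolynomial (Fin 2) F}
    (hp : p ∈ weightLT F f n) : aeval (delta L s i b) G p ∈ weightLT F f n := by
  rw [aeval_end_apply]
  refine Submodule.sum_mem _ fun m _ => Submodule.smul_mem _ _ ?_
  simpa [hf] using delta_pow_mem_weightLT L s f i b hp m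

theorem foldPoly_mem_weightLT (hL : 1 ≤ L) (hG : 2 ≤ G.natDegree) (i : Fin 2) :
    foldPoly L G s β ∈ weightLT F (expo i) (L * G.natDegree) := by
  -- `r σ` can have degree L in r, and `t σ` degree L in t; a degree of G at least 2 makes both fit
  -- below LM.
  have h1 : 1 + L ≤ L * G.natDegree := by nlinarith
  have hcd := cdPoly_mem_weightLT L s β hL (by omega : 1 ≤ G.natDegree)
  fin_cases i
  · rw [foldPoly_eq']
    have h2 := delta_mem_weightLT L s _ 1 (-β) (hcd 0)
    refine Submodule.add_mem _ (by simpa [expo_apply] using h2) ?_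
    refine aeval_delta_mem_weightLT L s _ (by simp [expo_apply]) (weightLT_mono ?_
      (X_mul_sigma_mem_weightLT L s _ (expo_single_le _) 0))
    simpa [expo_apply] using h1
  · have h2 := delta_mem_weightLT L s _ 0 β (hcd 1)
    refine Submodule.add_mem _ (by simpa [expo_apply] using h2) ?_
    refine aeval_delta_mem_weightLT L s _ (by simp [expo_apply]) (weightLT_mono ?_
      (X_mul_sigma_mem_weightLT L s _ (expo_single_le _) 1))
    simpa [expo_apply] using h1

theorem X_mul_X_mul_sigma_mem_weightLT (hL : 1 ≤ L) (hG : 2 ≤ G.natDegree) (i : Fin 2) :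
    MvPolynomial.X 0 * (MvPolynomial.X 1 * sigma L s) ∈
      weightLT F (expo i) (L * G.natDegree) := by
  have h1 : 1 + L ≤ L * G.natDegree := by nlinarith
  refine weightLT_mono ?_ (mul_mem_weightLT (X_mem_weightLT 0)
    (X_mul_sigma_mem_weightLT L s _ (expo_single_le i) 1))
  fin_cases i <;> simpa [expo_apply] using h1

/-! ### The leading part and the first row -/

/-- The total degree of a monomial. -/
def totalExpo : (Fin 2 →₀ ℕ) →+ ℕ :=
  expo 0 + expo 1

theorem totalExpo_apply (m : Fin 2 →₀ ℕ) : totalExpo m = m 0 + m 1 :=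
  rfl

theorem totalExpo_single (i : Fin 2) : totalExpo (Finsupp.single i 1) = 1 := by
  fin_cases i <;> simp [totalExpo_apply]

theorem SVar_sub_mem_weightLT (hL : 1 ≤ L) (i : Fin 2) :
    SVar L s i - MvPolynomial.C ((L : F) * s L) * MvPolynomial.X i ^ L
      ∈ weightLT F totalExpo L := by
  rw [SVar_eq, ← Finset.sum_erase_eq_sub (Finset.mem_Icc.mpr ⟨hL, le_rfl⟩)]
  refine Submodule.sum_mem _ fun k hk => C_mul_mem_weightLT _
    (weightLT_mono ?_ (X_pow_mem_weightLT i k))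
  have := Finset.mem_Icc.mp (Finset.mem_of_mem_erase hk)
  have := Finset.ne_of_mem_erase hk
  rw [totalExpo_single]
  omega

theorem C_mul_X_pow_mem_weightLT (c : F) (i : Fin 2) (k : ℕ) :
    MvPolynomial.C c * MvPolynomial.X i ^ k ∈ weightLT F totalExpo (k + 1) := by
  simpa [totalExpo_single] using
    C_mul_mem_weightLT c (X_pow_mem_weightLT (F := F) (f := totalExpo) i k)

/-- To leading order in total degree the operator is multiplication by L s_L z^L: the Euler part
preserves degree, hence is of lower order as L ≥ 1. -/
theorem delta_sub_mem_weightLT (hL : 1 ≤ L) (i : Fin 2) (b : F) {n : ℕ}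
    {p : MvPolynomial (Fin 2) F} (hp : p ∈ weightLT F totalExpo (n + 1)) :
    delta L s i b p - MvPolynomial.C ((L : F) * s L) * MvPolynomial.X i ^ L * p
      ∈ weightLT F totalExpo (n + L) := by
  have h1 := mul_mem_weightLT hp (SVar_sub_mem_weightLT L s hL i)
  have h2 := C_mul_mem_weightLT b (X_mul_pderiv_mem_weightLT i hp)
  have h3 := Submodule.add_mem _ h1 (weightLT_mono (Nat.add_le_add_left hL n) h2)
  rw [delta_apply]
  convert h3 using 1
  ring

theorem delta_pow_sub_mem_weightLT (hL : 1 ≤ L) (i : Fin 2) (b : F) {n : ℕ}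
    {p : MvPolynomial (Fin 2) F} (hp : p ∈ weightLT F totalExpo (n + 1)) (m : ℕ) :
    (delta L s i b ^ m) p - (MvPolynomial.C ((L : F) * s L) * MvPolynomial.X i ^ L) ^ m * p
      ∈ weightLT F totalExpo (n + L * m) := by
  induction m with
  | zero => simp
  | succ m ih =>
    have h0 := delta_pow_mem_weightLT L s totalExpo i b hp m
    rw [totalExpo_single, mul_one, add_right_comm] at h0
    have h1 := delta_sub_mem_weightLT L s hL i b h0
    have h2 := mul_mem_weightLT (C_mul_X_pow_mem_weightLT ((L : F) * s L) i L) ih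
    have h3 := Submodule.add_mem _ h1 (weightLT_mono (by rw [add_comm]) h2)
    rw [pow_succ', Module.End.mul_apply, mul_add, mul_one, ← add_assoc]
    convert h3 using 1
    ring

theorem cdMonomial_mem_weightLT_totalExpo (m : ℕ) :
    cdMonomial L s β m ∈ weightLT F totalExpo (L * m + 1) := by
  induction m with
  | zero => simpa [cdMonomial] using one_mem_weightLT
  | succ m ih =>
    rw [cdMonomial_succ]
    have h1 := delta_mem_weightLT L s _ 1 (-β) ih
    have h2 := delta_pow_mem_weightLT L s _ 0 β (X_mul_sigma_mem_weightLT L s totalExpo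
      (fun i => (totalExpo_single i).le) 1) m
    simp only [totalExpo_single, mul_one] at h1 h2
    exact Submodule.sub_mem _ (weightLT_mono (by rw [mul_add]; omega) h1)
      (weightLT_mono (by rw [mul_add]; omega) h2)

/-- Modulo lower total degree, both operators act on polynomials as multiplications by c z^L with c
= L s_L. The mixed terms r^(L+1) t^(Lm) cancel in the inductive step. -/
theorem X_sub_X_mul_cdMonomial (hL : 1 ≤ L) (m : ℕ) :
    (MvPolynomial.X 0 - MvPolynomial.X 1) * cdMonomial L s β m
      - MvPolynomial.C ((L : F) * s L) ^ m * (MvPolynomial.X 0 * MvPolynomial.X 1 ^ (L * m)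
        - MvPolynomial.X 1 * MvPolynomial.X 0 ^ (L * m)) ∈ weightLT F totalExpo (L * m + 1) := by
  induction m with
  | zero => simp [cdMonomial]
  | succ m ih =>
    have hX (i : Fin 2) : (MvPolynomial.X i : MvPolynomial (Fin 2) F)
        ∈ weightLT F totalExpo (1 + 1) := by
      simpa only [totalExpo_single] using X_mem_weightLT (F := F) (f := totalExpo) i
    have hsub := Submodule.sub_mem _ (hX 0) (hX 1)
    have hσ := X_mul_sigma_mem_weightLT L s totalExpo (fun i => (totalExpo_single i).le) 0
    rw [totalExpo_single, add_comm] at hσ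
    have h1 := mul_mem_weightLT hsub
      (delta_sub_mem_weightLT L s hL 0 β (cdMonomial_mem_weightLT_totalExpo L s β m))
    have h2 := mul_mem_weightLT (C_mul_X_pow_mem_weightLT ((L : F) * s L) 0 L) ih
    have h3 := mul_mem_weightLT hsub (delta_pow_sub_mem_weightLT L s hL 1 (-β) hσ m)
    have h4 := mul_mem_weightLT (hX 0) (Submodule.sub_mem _ (SVar_sub_mem_weightLT L s hL 0)
      (SVar_sub_mem_weightLT L s hL 1))
    have h5 := mul_mem_weightLT
      (C_mul_X_pow_mem_weightLT (((L : F) * s L) ^ m) 1 (L * m)) h4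
    have e : L * (m + 1) + 1 = 1 + (L * m + L) := by ring
    rw [← add_assoc, add_comm] at h2
    rw [add_comm L (L * m)] at h3
    rw [add_left_comm] at h5
    rw [e]
    have h6 := Submodule.sub_mem _ (Submodule.add_mem _ h1
      (weightLT_mono (by omega : _ ≤ 1 + (L * m + L)) h2)) (Submodule.add_mem _ h3 h5)
    rw [cdMonomial_succ']
    convert h6 using 1
    -- The error terms of S(r) and S(t) enter through (r - t) σ = S(r) - S(t), the only relation
    -- needed besides ring identities.
    have hs := sigma_mul L s
    simp only [map_mul, map_pow]
    linear_combination (-(MvPolynomial.C (L : F) * MvPolynomial.C (s L)) ^ m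
      * MvPolynomial.X 1 ^ (L * m) * MvPolynomial.X 0) * hs

end ChristoffelDarboux

/-! ### Invertibility of the Christoffel-Darboux matrix -/

/-- The coefficient of `r ^ i * t ^ j`. -/
def coeffXY {F : Type*} [Field F] (i j : ℕ) : MvPolynomial (Fin 2) F →ₗ[F] F :=
  MvPolynomial.lcoeff F (Finsupp.single 0 i + Finsupp.single 1 j)

section Coefficients

variable {F : Type*} [Field F]

theorem coeffXY_apply (i j : ℕ) (p : MvPolynomial (Fin 2) F) :
    coeffXY i j p = MvPolynomial.coeff (Finsupp.single 0 i + Finsupp.single 1 j) p :=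
  rfl

theorem single_add_single_eq (m : Fin 2 →₀ ℕ) :
    Finsupp.single 0 (m 0) + Finsupp.single 1 (m 1) = m := by
  ext k
  fin_cases k <;> simp

theorem single_add_single_injective {i j i' j' : ℕ}
    (h : (Finsupp.single 0 i + Finsupp.single 1 j : Fin 2 →₀ ℕ)
      = Finsupp.single 0 i' + Finsupp.single 1 j') : i = i' ∧ j = j' := by
  have h0 := DFunLike.congr_fun h 0
  have h1 := DFunLike.congr_fun h 1
  simp at h0 h1
  exact ⟨h0, h1⟩

theorem monomial_eq_C_mul (i j : ℕ) (c : F) :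
    MvPolynomial.monomial (Finsupp.single 0 i + Finsupp.single 1 j : Fin 2 →₀ ℕ) c
      = MvPolynomial.C c * (MvPolynomial.X 0 ^ i * MvPolynomial.X 1 ^ j) := by
  rw [MvPolynomial.X_pow_eq_monomial, MvPolynomial.X_pow_eq_monomial, MvPolynomial.monomial_mul,
    MvPolynomial.C_mul_monomial, one_mul, mul_one]

theorem coeffXY_C_mul_X_pow (i j k l : ℕ) (c : F) :
    coeffXY i j (MvPolynomial.C c * (MvPolynomial.X 0 ^ k * MvPolynomial.X 1 ^ l))
      = if i = k ∧ j = l then c else 0 := by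
  classical
  rw [← monomial_eq_C_mul, coeffXY_apply, MvPolynomial.coeff_monomial]
  refine if_congr ⟨fun h => ?_, fun h => by rw [h.1, h.2]⟩ rfl rfl
  exact single_add_single_injective h.symm

theorem coeffXY_succ_X_zero_mul (i j : ℕ) (p : MvPolynomial (Fin 2) F) :
    coeffXY (i + 1) j (MvPolynomial.X 0 * p) = coeffXY i j p := by
  rw [coeffXY_apply, coeffXY_apply, Finsupp.single_add, add_comm (Finsupp.single 0 i), add_assoc,
    MvPolynomial.coeff_X_mul]

theorem coeffXY_succ_X_one_mul (i j : ℕ) (p : MvPolynomial (Fin 2) F) :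
    coeffXY i (j + 1) (MvPolynomial.X 1 * p) = coeffXY i j p := by
  rw [coeffXY_apply, coeffXY_apply, Finsupp.single_add, add_comm (Finsupp.single 1 j),
    add_left_comm, MvPolynomial.coeff_X_mul]

theorem coeffXY_zero_X_zero_mul (j : ℕ) (p : MvPolynomial (Fin 2) F) :
    coeffXY 0 j (MvPolynomial.X 0 * p) = 0 := by
  classical
  rw [coeffXY_apply, MvPolynomial.coeff_X_mul', if_neg]
  simp

theorem coeffXY_eq_zero {n i j : ℕ} {p : MvPolynomial (Fin 2) F}
    (hp : p ∈ weightLT F totalExpo n) (h : n ≤ i + j) : coeffXY i j p = 0 :=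
  hp _ (by simpa [totalExpo_apply] using h)

/-- A polynomial of degree less than `n` in both variables is the sum of its monomials. -/
theorem sum_coeffXY {n : ℕ} {p : MvPolynomial (Fin 2) F} (hp : ∀ i, p ∈ weightLT F (expo i) n) :
    ∑ i : Fin n, ∑ j : Fin n, MvPolynomial.C (coeffXY i j p)
      * (MvPolynomial.X 0 ^ (i : ℕ) * MvPolynomial.X 1 ^ (j : ℕ)) = p := by
  let g (i j : ℕ) : MvPolynomial (Fin 2) F :=
    MvPolynomial.C (coeffXY i j p) * (MvPolynomial.X 0 ^ i * MvPolynomial.X 1 ^ j)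
  have e : ∑ i : Fin n, ∑ j : Fin n, g i j = ∑ i ∈ Finset.range n, ∑ j ∈ Finset.range n, g i j := by
    rw [← Fin.sum_univ_eq_sum_range (fun i => ∑ j ∈ Finset.range n, g i j)]
    exact Finset.sum_congr rfl fun i _ => Fin.sum_univ_eq_sum_range (g i) n
  refine e.trans ?_
  ext m
  rw [← single_add_single_eq m]
  simp only [← coeffXY_apply, map_sum, g, coeffXY_C_mul_X_pow]
  by_cases h : m 0 < n ∧ m 1 < n
  · rw [Finset.sum_eq_single_of_mem (m 0) (Finset.mem_range.mpr h.1),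
      Finset.sum_eq_single_of_mem (m 1) (Finset.mem_range.mpr h.2), if_pos ⟨rfl, rfl⟩]
    · exact fun j _ hj => if_neg fun e => hj e.2.symm
    · exact fun i _ hi => Finset.sum_eq_zero fun j _ => if_neg fun e => hi e.1.symm
  · rw [Finset.sum_eq_zero]
    · rw [coeffXY_apply, single_add_single_eq]
      rcases not_and_or.mp h with h | h
      · exact (hp 0 m (not_lt.mp h)).symm
      · exact (hp 1 m (not_lt.mp h)).symm
    · intro i hi
      refine Finset.sum_eq_zero fun j hj => if_neg ?_
      rintro ⟨rfl, rfl⟩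
      exact h ⟨Finset.mem_range.mp hi, Finset.mem_range.mp hj⟩

variable (L : ℕ) (G : F[X]) (s : ℕ → F) (β : F)

theorem X_dvd_delta (i : Fin 2) (b : F) (p : MvPolynomial (Fin 2) F) :
    MvPolynomial.X i ∣ delta L s i b p := by
  rw [delta_apply, SVar_eq]
  refine dvd_add (Dvd.dvd.mul_right (Finset.dvd_sum fun k hk => Dvd.dvd.mul_left
    (dvd_pow_self _ ?_) _) _) (Dvd.dvd.mul_left (dvd_mul_right _ _) _)
  have := (Finset.mem_Icc.mp hk).1
  omega

theorem delta_pow_X_mul {i j : Fin 2} (h : i ≠ j) (b : F) (m : ℕ) (p : MvPolynomial (Fin 2) F) :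
    (delta L s i b ^ m) (MvPolynomial.X j * p) = MvPolynomial.X j * (delta L s i b ^ m) p :=
  LinearMap.congr_fun ((commute_delta_mulLeft_X L s h b).pow_left m) p

/-- The second recursion exhibits a factor r in both terms: Δ₊ takes values in the multiples of r
because S(0) = 0, and Δ₋ commutes with multiplication by r. -/
theorem coeffXY_zero_cdMonomial_succ (m j : ℕ) :
    coeffXY 0 j (cdMonomial L s β (m + 1)) = 0 := by
  obtain ⟨q, hq⟩ := X_dvd_delta L s 0 β (cdMonomial L s β m)
  rw [cdMonomial_succ', hq, delta_pow_X_mul L s (by decide), map_sub, coeffXY_zero_X_zero_mul,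
    coeffXY_zero_X_zero_mul, sub_zero]

theorem coeffXY_zero_cdPoly (j : ℕ) :
    coeffXY 0 j (cdPoly L G s β) = if j = 0 then G.coeff 0 else 0 := by
  rw [cdPoly, Finset.sum_range_succ', map_add, map_sum, Finset.sum_eq_zero, zero_add, map_smul]
  · have h := coeffXY_C_mul_X_pow 0 j 0 0 (1 : F)
    simp only [map_one, pow_zero, mul_one, true_and] at h
    rw [cdMonomial, h]
    simp
  · intro m _
    rw [map_smul, coeffXY_zero_cdMonomial_succ, smul_zero]

/-- Dividing r t^N - t r^N by r - t, with N = Lm, leaves minus the sum of all r^a t^b with a, b ≥ 1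
and a + b = N. The division is done coefficientwise along the antidiagonal, starting from the
vanishing coefficient of t^N. -/
theorem coeffXY_cdMonomial (hL : 1 ≤ L) (m i j : ℕ) (h : i + 1 + (j + 1) = L * m) :
    coeffXY (i + 1) (j + 1) (cdMonomial L s β m) = -((L : F) * s L) ^ m := by
  have key (k l : ℕ) (hkl : k + 1 + l = L * m) :
      coeffXY k (l + 1) (cdMonomial L s β m) - coeffXY (k + 1) l (cdMonomial L s β m)
        = (if k = 0 then ((L : F) * s L) ^ m else 0)
          - if l = 0 then ((L : F) * s L) ^ m else 0 := by
    have h1 := coeffXY_eq_zero (X_sub_X_mul_cdMonomial L s β hL m)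
      (by omega : L * m + 1 ≤ (k + 1) + (l + 1))
    have e (a b : ℕ) := coeffXY_C_mul_X_pow (k + 1) (l + 1) a b (((L : F) * s L) ^ m)
    have e1 := e 1 (L * m)
    have e2 := e (L * m) 1
    rw [map_pow, pow_one] at e1 e2
    rw [sub_mul, mul_sub, mul_comm (MvPolynomial.X 1) (MvPolynomial.X 0 ^ (L * m)), map_sub,
      map_sub, map_sub, coeffXY_succ_X_zero_mul, coeffXY_succ_X_one_mul, e1, e2] at h1
    -- On this antidiagonal k = 0 corresponds to the monomial r t^(Lm), and l = 0 to r^(Lm) t.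
    rw [sub_eq_zero.mp h1]
    congr 1
    · exact if_congr (by omega) rfl rfl
    · exact if_congr (by omega) rfl rfl
  induction i generalizing j with
  | zero =>
    have h1 := key 0 (j + 1) (by omega)
    obtain ⟨m, rfl⟩ : ∃ k, m = k + 1 :=
      Nat.exists_eq_succ_of_ne_zero (by rintro rfl; omega)
    rw [coeffXY_zero_cdMonomial_succ, if_pos rfl, if_neg (Nat.succ_ne_zero j)] at h1
    linear_combination -h1
  | succ i ih =>
    have h1 := key (i + 1) (j + 1) (by omega)
    rw [ih (j + 1) (by omega), if_neg (Nat.succ_ne_zero i), if_neg (Nat.succ_ne_zero j)] at h1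
    linear_combination -h1

theorem coeffXY_cdPoly_of_eq (hL : 1 ≤ L) (i j : ℕ) (h : i + 1 + (j + 1) = L * G.natDegree) :
    coeffXY (i + 1) (j + 1) (cdPoly L G s β)
      = -(G.leadingCoeff * ((L : F) * s L) ^ G.natDegree) := by
  rw [cdPoly, Finset.sum_range_succ, map_add, map_smul, coeffXY_cdMonomial L s β hL _ i j h,
    map_sum, Finset.sum_eq_zero, zero_add, smul_eq_mul, mul_neg]
  · rfl
  · intro m hm
    have hm' : m + 1 ≤ G.natDegree := Finset.mem_range.mp hm
    have hm2 := Nat.mul_le_mul_left L hm'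
    rw [mul_add] at hm2
    rw [map_smul, coeffXY_eq_zero (cdMonomial_mem_weightLT_totalExpo L s β m) (by omega),
      smul_zero]

theorem coeffXY_cdPoly_of_gt (i j : ℕ) (h : L * G.natDegree < i + j) :
    coeffXY i j (cdPoly L G s β) = 0 := by
  rw [cdPoly, map_sum]
  refine Finset.sum_eq_zero fun m hm => ?_
  have hm2 := Nat.mul_le_mul_left L (Nat.lt_succ_iff.mp (Finset.mem_range.mp hm))
  rw [map_smul, coeffXY_eq_zero (cdMonomial_mem_weightLT_totalExpo L s β m) (by omega),
    smul_zero]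

/-- A matrix whose first row is the first unit vector, and which is triangular with respect to
the antidiagonal `i + j = n`, is invertible. -/
theorem isUnit_det_of_antitriangular {n : ℕ} (A : Matrix (Fin n) (Fin n) F)
    (h00 : ∀ i : Fin n, (i : ℕ) = 0 → A i i = 1)
    (h0 : ∀ i j : Fin n, (i : ℕ) = 0 → (j : ℕ) ≠ 0 → A i j = 0)
    (hgt : ∀ i j : Fin n, n < (i : ℕ) + j → A i j = 0)
    (heq : ∀ i j : Fin n, (i : ℕ) + j = n → A i j ≠ 0) : IsUnit A.det := by
  rw [isUnit_iff_ne_zero]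
  intro hdet
  obtain ⟨v, hv, hAv⟩ := Matrix.exists_mulVec_eq_zero_iff.mpr hdet
  have row (i : Fin n) : ∑ j, A i j * v j = 0 := congrFun hAv i
  have hv0 : ∀ (k : ℕ) (j : Fin n), (j : ℕ) = k → v j = 0 := by
    intro k
    induction k using Nat.strong_induction_on with
    | _ k ih =>
      intro j hj
      rcases Nat.eq_zero_or_pos k with rfl | hk
      · have h := row j
        rw [Finset.sum_eq_single j, h00 j hj, one_mul] at h
        · exact h
        · intro l _ hl
          rw [h0 j l hj (fun e => hl (Fin.ext (e.trans hj.symm))), zero_mul]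
        · simp
      -- Row n - k meets the antidiagonal in column k: earlier columns vanish by induction on the
      -- kernel vector, later ones by triangularity.
      · have h := row ⟨n - k, by omega⟩
        rw [Finset.sum_eq_single j] at h
        · exact (mul_eq_zero.mp h).resolve_left (heq _ _ (by simp only; omega))
        · intro l _ hl
          rcases lt_or_gt_of_ne (fun e : (l : ℕ) = k => hl (Fin.ext (e.trans hj.symm)))
            with hlt | hgt'
          · rw [ih l hlt l rfl, mul_zero]
          · rw [hgt _ _ (by simp only; omega), zero_mul]
        · simp
  exact hv (funext fun j => hv0 j j rfl)

end Coefficients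

/-! ### The generating functions as polynomials -/

section RationalFunctions

variable {F : Type*} [Field F] (L : ℕ) (s : ℕ → F)

theorem eulerRT_algebraMap (i : Fin 2) (p : MvPolynomial (Fin 2) F) :
    eulerRT F i (algebraMap _ _ p)
      = algebraMap _ _ (MvPolynomial.X i * MvPolynomial.pderiv i p) := by
  have h := fracDerivFun_div ((MvPolynomial.X i : MvPolynomial (Fin 2) F) • MvPolynomial.pderiv i)
    p 1 one_ne_zero
  simp only [map_one, div_one, Derivation.map_one_eq_zero, mul_one, mul_zero, sub_zero,
    one_pow] at h
  exact h

/-- A derivation of the rational functions is determined by its values on polynomials. -/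
theorem derivation_eq_zero (D : Derivation F (RatRT F) (RatRT F))
    (h : ∀ p : MvPolynomial (Fin 2) F, D (algebraMap _ _ p) = 0) (f : RatRT F) : D f = 0 := by
  obtain ⟨a, b, _, rfl⟩ := IsFractionRing.div_surjective (A := MvPolynomial (Fin 2) F) f
  simp [Derivation.leibniz_div, h]

/-- The commutator of two derivations is a derivation, so it suffices that it vanishes on
polynomials. -/
theorem eulerRT_comm (f : RatRT F) : eulerRT F 0 (eulerRT F 1 f) = eulerRT F 1 (eulerRT F 0 f) := by
  rw [← sub_eq_zero, ← Derivation.commutator_apply]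
  refine derivation_eq_zero _ (fun p => ?_) f
  have h : MvPolynomial.X 0 * MvPolynomial.pderiv 0 (MvPolynomial.X 1 * MvPolynomial.pderiv 1 p)
      = MvPolynomial.X 1 * MvPolynomial.pderiv 1 (MvPolynomial.X 0 * MvPolynomial.pderiv 0 p) := by
    ext m
    simp only [coeff_X_mul_pderiv]
    ring
  rw [Derivation.commutator_apply, eulerRT_algebraMap, eulerRT_algebraMap, eulerRT_algebraMap,
    eulerRT_algebraMap, h, sub_self]

/-- `S(X_i) + b X_i ∂/∂X_i`, on rational functions. -/
def deltaRat (i : Fin 2) (b : F) : Module.End F (RatRT F) :=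
  LinearMap.mulLeft F (algebraMap _ (RatRT F) (SVar L s i))
    + b • (eulerRT F i : RatRT F →ₗ[F] RatRT F)

theorem deltaRat_apply (i : Fin 2) (b : F) (f : RatRT F) :
    deltaRat L s i b f = algebraMap _ (RatRT F) (SVar L s i) * f + b • eulerRT F i f :=
  rfl

theorem aeval_rVar_SPoly : aeval (rVar F) (SPoly L s) = algebraMap _ (RatRT F) (SVar L s 0) :=
  aeval_algebraMap_apply _ _ _

theorem aeval_tVar_SPoly : aeval (tVar F) (SPoly L s) = algebraMap _ (RatRT F) (SVar L s 1) :=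
  aeval_algebraMap_apply _ _ _

theorem deltaPlus_eq (β : F) : deltaPlus L s β = deltaRat L s 0 β := by
  rw [deltaPlus, deltaRat, aeval_rVar_SPoly]

theorem deltaMinus_eq (β : F) : deltaMinus L s β = deltaRat L s 1 (-β) := by
  refine LinearMap.ext fun f => ?_
  rw [deltaRat_apply, neg_smul, ← sub_eq_add_neg, ← aeval_tVar_SPoly]
  rfl

theorem algebraMap_C_eq (b : F) :
    algebraMap (MvPolynomial (Fin 2) F) (RatRT F) (MvPolynomial.C b) = algebraMap F (RatRT F) b :=
  (IsScalarTower.algebraMap_apply F (MvPolynomial (Fin 2) F) (RatRT F) b).symm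

theorem deltaRat_algebraMap (i : Fin 2) (b : F) (p : MvPolynomial (Fin 2) F) :
    deltaRat L s i b (algebraMap _ _ p) = algebraMap _ _ (delta L s i b p) := by
  rw [deltaRat_apply, delta_apply, eulerRT_algebraMap, map_add, Algebra.smul_def, ← algebraMap_C_eq]
  simp only [map_mul]

theorem deltaRat_pow_algebraMap (i : Fin 2) (b : F) (m : ℕ) (p : MvPolynomial (Fin 2) F) :
    (deltaRat L s i b ^ m) (algebraMap _ _ p) = algebraMap _ _ ((delta L s i b ^ m) p) := by
  induction m with
  | zero => rfl
  | succ m ih =>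
    rw [pow_succ', pow_succ', Module.End.mul_apply, Module.End.mul_apply, ih, deltaRat_algebraMap]

theorem algebraMap_smul_eq (c : F) (p : MvPolynomial (Fin 2) F) :
    algebraMap _ (RatRT F) (c • p) = c • algebraMap _ (RatRT F) p := by
  rw [Algebra.smul_def, Algebra.smul_def, map_mul, ← IsScalarTower.algebraMap_apply]

theorem aeval_deltaRat_algebraMap (G : F[X]) (i : Fin 2) (b : F) (p : MvPolynomial (Fin 2) F) :
    aeval (deltaRat L s i b) G (algebraMap _ _ p)
      = algebraMap _ _ (aeval (delta L s i b) G p) := by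
  simp only [aeval_end_apply, deltaRat_pow_algebraMap, map_sum, algebraMap_smul_eq]

theorem eulerRT_SVar {i j : Fin 2} (h : i ≠ j) :
    eulerRT F i (algebraMap _ _ (SVar L s j)) = 0 := by
  rw [eulerRT_algebraMap, pderiv_SVar L s h, mul_zero, map_zero]

theorem deltaRat_commute (b c : F) : Commute (deltaRat L s 0 b) (deltaRat L s 1 c) := by
  refine LinearMap.ext fun f => ?_
  simp only [Module.End.mul_apply, deltaRat_apply, map_add, Derivation.map_smul,
    Derivation.leibniz, eulerRT_SVar L s (i := 0) (j := 1) (by decide),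
    eulerRT_SVar L s (i := 1) (j := 0) (by decide), eulerRT_comm f]
  simp only [Algebra.smul_def, Algebra.algebraMap_self, RingHom.id_apply]
  ring

theorem eulerRT_rVar : eulerRT F 0 (rVar F) = rVar F := by
  rw [rVar, eulerRT_algebraMap, MvPolynomial.pderiv_X_self, mul_one]

theorem eulerRT_tVar : eulerRT F 1 (tVar F) = tVar F := by
  rw [tVar, eulerRT_algebraMap, MvPolynomial.pderiv_X_self, mul_one]

theorem eulerRT_one_rVar : eulerRT F 1 (rVar F) = 0 := by
  rw [rVar, eulerRT_algebraMap, MvPolynomial.pderiv_X_of_ne (by decide), mul_zero, map_zero]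

theorem eulerRT_zero_tVar : eulerRT F 0 (tVar F) = 0 := by
  rw [tVar, eulerRT_algebraMap, MvPolynomial.pderiv_X_of_ne (by decide), mul_zero, map_zero]

theorem rVar_sub_tVar_ne_zero : rVar F - tVar F ≠ 0 := by
  rw [rVar, tVar, sub_ne_zero]
  intro h
  have h1 := MvPolynomial.X_injective (IsFractionRing.injective (MvPolynomial (Fin 2) F) (RatRT F) h)
  exact absurd h1 (by decide)

theorem commute_mulLeft {i : Fin 2} {g : RatRT F} (hg : eulerRT F i g = 0) (b : F) :
    Commute (deltaRat L s i b) (LinearMap.mulLeft F g) := by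
  refine LinearMap.ext fun f => ?_
  simp only [Module.End.mul_apply, deltaRat_apply, LinearMap.mulLeft_apply, Derivation.leibniz, hg]
  simp only [Algebra.smul_def, Algebra.algebraMap_self, RingHom.id_apply]
  ring

/-- The Euler parts contribute β(r∂_r + t∂_t) of a function homogeneous of degree 0, hence nothing;
only (S(r) - S(t)) t/(r - t) survives. -/
theorem deltaRat_sub_tVar_div (β : F) :
    deltaRat L s 0 β (tVar F * (1 / (rVar F - tVar F)))
        - deltaRat L s 1 (-β) (tVar F * (1 / (rVar F - tVar F)))
      = algebraMap _ _ (MvPolynomial.X 1 * sigma L s) := by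
  have hne := rVar_sub_tVar_ne_zero (F := F)
  have hσ := congrArg (algebraMap _ (RatRT F)) (sigma_mul L s)
  rw [map_mul, map_sub, map_sub] at hσ
  change _ * (rVar F - tVar F) = _ at hσ
  conv_rhs => rw [map_mul]
  change _ = tVar F * _
  rw [mul_one_div, deltaRat_apply, deltaRat_apply, Derivation.leibniz_div, Derivation.leibniz_div,
    map_sub, map_sub, eulerRT_rVar, eulerRT_tVar, eulerRT_one_rVar, eulerRT_zero_tVar, neg_smul]
  simp only [Algebra.smul_def, Algebra.algebraMap_self, RingHom.id_apply]
  field_simp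
  linear_combination -(tVar F * (rVar F - tVar F)) * hσ

theorem algebraMap_cdMonomial (β : F) (m : ℕ) :
    algebraMap _ _ (cdMonomial L s β m)
      = (deltaRat L s 1 (-β) ^ m) (rVar F * (1 / (rVar F - tVar F)))
        - (deltaRat L s 0 β ^ m) (tVar F * (1 / (rVar F - tVar F))) := by
  induction m with
  | zero =>
    have hne := rVar_sub_tVar_ne_zero (F := F)
    simp only [cdMonomial, map_one, pow_zero, Module.End.one_apply]
    field_simp
  | succ m ih =>
    have h := LinearMap.congr_fun ((deltaRat_commute L s β (-β)).pow_left m)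
      (tVar F * (1 / (rVar F - tVar F)))
    simp only [Module.End.mul_apply] at h
    rw [cdMonomial_succ, map_sub, ← deltaRat_algebraMap, ← deltaRat_pow_algebraMap,
      ← deltaRat_sub_tVar_div L s β, ih, map_sub, map_sub, h, pow_succ', Module.End.mul_apply,
      pow_succ, Module.End.mul_apply]
    abel

variable (G : F[X]) (β : F)

/-- The variable r is a constant for the derivation in t, so it passes through every power of Δ₋. -/
theorem rVar_mul_VMinus (f : RatRT F) :
    rVar F * VMinus L G s β f = aeval (deltaRat L s 1 (-β)) G (rVar F * f) := by
  have h (m : ℕ) := LinearMap.congr_fun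
    ((commute_mulLeft L s (eulerRT_one_rVar (F := F)) (-β)).pow_left m) f
  simp only [Module.End.mul_apply, LinearMap.mulLeft_apply] at h
  simp only [VMinus, deltaMinus_eq, aeval_end_apply, Finset.mul_sum, h, mul_smul_comm]

theorem tVar_mul_VPlus (f : RatRT F) :
    tVar F * VPlus L G s β f = aeval (deltaRat L s 0 β) G (tVar F * f) := by
  have h (m : ℕ) := LinearMap.congr_fun
    ((commute_mulLeft L s (eulerRT_zero_tVar (F := F)) β).pow_left m) f
  simp only [Module.End.mul_apply, LinearMap.mulLeft_apply] at h
  simp only [VPlus, deltaPlus_eq, aeval_end_apply, Finset.mul_sum, h, mul_smul_comm]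

theorem AGen_eq : AGen L G s β = algebraMap _ _ (cdPoly L G s β) := by
  rw [AGen, rVar_mul_VMinus, tVar_mul_VPlus, cdPoly, map_sum]
  simp only [algebraMap_smul_eq, algebraMap_cdMonomial, aeval_end_apply, smul_sub,
    Finset.sum_sub_distrib]

theorem CGen_eq : CGen L G s β = algebraMap _ _ (foldPoly L G s β) := by
  have hA := AGen_eq L s G β
  -- Replacing r V₋ u by A + t V₊ u leaves Δ₊A + (Δ₊ - Δ₋) V₊(t u), and the difference can be moved
  -- inside V₊ by commutation.
  rw [AGen, sub_eq_iff_eq_add] at hA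
  rw [CGen, hA, map_add, deltaPlus_eq, deltaMinus_eq, deltaRat_algebraMap, foldPoly, map_add,
    ← aeval_deltaRat_algebraMap, ← deltaRat_sub_tVar_div L s β, map_sub, tVar_mul_VPlus]
  have h (b : F) {j : Fin 2} (h : Commute (deltaRat L s 0 β) (deltaRat L s j b)) :
      aeval (deltaRat L s 0 β) G (deltaRat L s j b (tVar F * (1 / (rVar F - tVar F))))
        = deltaRat L s j b (aeval (deltaRat L s 0 β) G (tVar F * (1 / (rVar F - tVar F)))) := by
    have h' (m : ℕ) := LinearMap.congr_fun (h.pow_left m) (tVar F * (1 / (rVar F - tVar F)))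
    simp only [Module.End.mul_apply] at h'
    simp only [aeval_end_apply, h', map_sum, map_smul]
  rw [h β (Commute.refl _), h (-β) (deltaRat_commute L s β (-β))]
  abel

theorem BGen_eq :
    BGen L s = algebraMap _ _ (MvPolynomial.X 0 * (MvPolynomial.X 1 * sigma L s)) := by
  rw [BGen, aeval_rVar_SPoly, aeval_tVar_SPoly, ← map_sub, ← sigma_mul, map_mul, map_sub,
    map_mul, map_mul]
  change rVar F * tVar F * (_ * (rVar F - tVar F)) / _ = rVar F * (tVar F * _)
  rw [← mul_assoc, mul_div_assoc, div_self rVar_sub_tVar_ne_zero, mul_one, mul_assoc]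

theorem coeffRT_algebraMap (p : MvPolynomial (Fin 2) F) (i j : ℕ) :
    coeffRT (algebraMap _ (RatRT F) p) i j = coeffXY i j p := by
  have h : ∃ q : MvPolynomial (Fin 2) F, algebraMap _ (RatRT F) q = algebraMap _ _ p := ⟨p, rfl⟩
  rw [coeffRT, dif_pos h, IsFractionRing.injective _ (RatRT F) h.choose_spec, coeffXY_apply]

theorem sum_coeffXY_RatRT {n : ℕ} {p : MvPolynomial (Fin 2) F}
    (hp : ∀ i, p ∈ weightLT F (expo i) n) :
    ∑ i : Fin n, ∑ j : Fin n, algebraMap F (RatRT F) (coeffXY i j p)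
      * (rVar F ^ (i : ℕ) * tVar F ^ (j : ℕ)) = algebraMap _ _ p := by
  conv_rhs => rw [← sum_coeffXY hp]
  simp only [map_sum, map_mul, map_pow, algebraMap_C_eq]
  rfl

end RationalFunctions

/-! ### The adapted bases as functionals -/

section AdaptedBases

variable {F : Type*} [Field F]

theorem coeff_seriesFrom (k : ℤ) (a : ℤ → F) (n : ℤ) :
    (seriesFrom k a).coeff n = if k ≤ n then a n else 0 :=
  rfl

theorem coeff_eulerD (f : LaurentSeries F) (n : ℤ) : (eulerD f).coeff n = (n : F) * f.coeff n := by
  rw [eulerD, HahnSeries.coeff_single_mul, one_mul, LaurentSeries.derivative_apply,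
    LaurentSeries.hasseDeriv_coeff]
  simp

/-- The operator `b D`. -/
def eulerEnd (b : F) : Module.End F (LaurentSeries F) where
  toFun f := b • eulerD f
  map_add' f g := by
    ext n
    simp only [HahnSeries.coeff_smul, HahnSeries.coeff_add, coeff_eulerD, smul_eq_mul]
    ring
  map_smul' c f := by
    ext n
    simp only [HahnSeries.coeff_smul, coeff_eulerD, smul_eq_mul, RingHom.id_apply]
    ring

theorem eulerEnd_apply (b : F) (f : LaurentSeries F) : eulerEnd b f = b • eulerD f :=
  rfl

theorem coeff_eulerEnd (b : F) (f : LaurentSeries F) (n : ℤ) :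
    (eulerEnd b f).coeff n = (n : F) * b * f.coeff n := by
  rw [eulerEnd_apply, HahnSeries.coeff_smul, coeff_eulerD, smul_eq_mul]
  ring

theorem coeff_aeval_eulerEnd (b : F) (G : F[X]) (f : LaurentSeries F) (n : ℤ) :
    (aeval (eulerEnd b) G f).coeff n = G.eval ((n : F) * b) * f.coeff n := by
  have h (m : ℕ) : ((eulerEnd b ^ m) f).coeff n = ((n : F) * b) ^ m * f.coeff n := by
    induction m with
    | zero => simp
    | succ m ih => rw [pow_succ', Module.End.mul_apply, coeff_eulerEnd, ih, pow_succ', mul_assoc,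
      mul_assoc, mul_assoc]
  rw [aeval_end_apply, HahnSeries.coeff_sum, eval_eq_sum_range, Finset.sum_mul]
  refine Finset.sum_congr rfl fun m _ => ?_
  rw [HahnSeries.coeff_smul, h, smul_eq_mul, mul_assoc]

/-! ### The exponential series and the two relations satisfied by an adapted basis -/

section Exponential

variable [CharZero F] (L : ℕ) (s : ℕ → F)

/-- Coefficient form of x d/dx exp(aξ) = a S(x) exp(aξ). -/
theorem hSym_succ (a : F) (j : ℕ) :
    (j : F) * hSym L s a j = a * ∑ k ∈ Finset.Icc 1 L,
      (k : F) * s k * if k ≤ j then hSym L s a (j - k) else 0 := by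
  set ξ : PowerSeries F := ∑ k ∈ Finset.Icc 1 L, PowerSeries.C (a * s k) * PowerSeries.X ^ k with hξ
  have h0 : PowerSeries.HasSubst ξ := by
    refine PowerSeries.HasSubst.of_constantCoeff_zero' ?_
    rw [hξ, map_sum]
    refine Finset.sum_eq_zero fun k hk => ?_
    have : k ≠ 0 := by have := (Finset.mem_Icc.mp hk).1; omega
    simp [this]
  have hder : PowerSeries.derivative F (expXi L s a)
      = expXi L s a * PowerSeries.derivative F ξ := by
    rw [expXi, PowerSeries.derivative_subst h0, PowerSeries.derivative_exp]
  have hX : PowerSeries.X * PowerSeries.derivative F ξ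
      = ∑ k ∈ Finset.Icc 1 L, PowerSeries.C (a * ((k : F) * s k)) * PowerSeries.X ^ k := by
    rw [hξ, map_sum, Finset.mul_sum]
    refine Finset.sum_congr rfl fun k hk => ?_
    obtain ⟨k, rfl⟩ : ∃ l, k = l + 1 :=
      Nat.exists_eq_succ_of_ne_zero (by have := (Finset.mem_Icc.mp hk).1; omega)
    ext n
    rcases n with _ | n
    · simp
    · rw [PowerSeries.coeff_succ_X_mul, PowerSeries.coeff_derivative, PowerSeries.coeff_C_mul,
        PowerSeries.coeff_C_mul, PowerSeries.coeff_X_pow]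
      split_ifs with h
      · have : n = k := by omega
        subst this
        push_cast
        ring
      · simp
  have hj : (j : F) * hSym L s a j
      = PowerSeries.coeff j (PowerSeries.X * PowerSeries.derivative F (expXi L s a)) := by
    rcases j with _ | j
    · simp
    · rw [PowerSeries.coeff_succ_X_mul, PowerSeries.coeff_derivative, hSym]
      push_cast
      ring
  rw [hj, hder, mul_left_comm, hX, Finset.mul_sum, map_sum, Finset.mul_sum]
  refine Finset.sum_congr rfl fun k _ => ?_
  rw [mul_left_comm, PowerSeries.coeff_C_mul, PowerSeries.coeff_mul_X_pow']
  simp only [hSym, mul_assoc]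

/-- `∑_{n ≥ k} w_n * h_{n-k}(b⁻¹ s) * x ^ n`. -/
def adapted (b : F) (w : ℤ → F) (k : ℕ) : LaurentSeries F :=
  seriesFrom k fun n => w n * hSym L s b⁻¹ (n - k).toNat

/-- The right side mirrors (S(z) + b z d/dz) z^k with z^k replaced by the k-th series. It follows
from splitting n = (n - k) + k and applying `hSym_succ` to the first part; the weights w are
arbitrary. -/
theorem eulerEnd_adapted {b : F} (hb : b ≠ 0) (w : ℤ → F) (k : ℕ) :
    eulerEnd b (adapted L s b w k) = ∑ l ∈ Finset.Icc 1 L,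
        ((l : F) * s l) • adapted L s b w (k + l)
      + (b * (k : F)) • adapted L s b w k := by
  ext n
  rw [HahnSeries.coeff_add, HahnSeries.coeff_sum, coeff_eulerEnd]
  simp only [HahnSeries.coeff_smul, adapted, coeff_seriesFrom, smul_eq_mul]
  by_cases hn : (k : ℤ) ≤ n
  · obtain ⟨j, rfl⟩ := Int.le.dest hn
    have h := hSym_succ L s b⁻¹ j
    rw [if_pos hn, add_sub_cancel_left, Int.toNat_natCast]
    have e : ∑ l ∈ Finset.Icc 1 L, (l : F) * s l * (if ((k + l : ℕ) : ℤ) ≤ k + j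
          then w (k + j) * hSym L s b⁻¹ ((k : ℤ) + j - (k + l : ℕ)).toNat else 0)
        = w (k + j) * ∑ l ∈ Finset.Icc 1 L,
          (l : F) * s l * if l ≤ j then hSym L s b⁻¹ (j - l) else 0 := by
      rw [Finset.mul_sum]
      refine Finset.sum_congr rfl fun l _ => ?_
      by_cases hl : l ≤ j
      · rw [if_pos hl, if_pos (by push_cast; omega),
          show ((k : ℤ) + j - (k + l : ℕ)).toNat = j - l by push_cast; omega]
        ring
      · rw [if_neg hl, if_neg (by push_cast; omega)]
        ring
    rw [e]
    rw [eq_inv_mul_iff_mul_eq₀ hb] at h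
    push_cast
    linear_combination w (k + j) * h
  · rw [if_neg hn, Finset.sum_eq_zero]
    · simp
    · intro l _
      rw [if_neg (by push_cast; omega), mul_zero]

/-- G(bD) multiplies the coefficient of x^n by G(nb), which is what the recursion for w supplies.
Only n ≥ k ≥ 0 matters, so the recursion is required at natural numbers alone. -/
theorem adapted_succ {b γ : F} {G : F[X]} {w : ℤ → F}
    (hw : ∀ n : ℕ, w (n + 1) = γ * G.eval ((n : F) * b) * w n) (k : ℕ) :
    adapted L s b w (k + 1)
      = HahnSeries.single 1 γ * aeval (eulerEnd b) G (adapted L s b w k) := by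
  ext n
  rw [HahnSeries.coeff_single_mul, coeff_aeval_eulerEnd]
  simp only [adapted, coeff_seriesFrom]
  by_cases hn : (k : ℤ) ≤ n - 1
  · obtain ⟨m, hm⟩ := Int.eq_ofNat_of_zero_le ((Int.natCast_nonneg k).trans hn)
    obtain rfl : n = m + 1 := by omega
    rw [if_pos hn, if_pos (by push_cast; omega), hw, add_sub_cancel_right,
      show ((m : ℤ) + 1 - (k + 1 : ℕ)) = m - k by push_cast; ring]
    push_cast
    ring
  · rw [if_neg hn, if_neg (by push_cast; omega), mul_zero, mul_zero]

end Exponential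

/-! ### Functionals pairing one variable with an adapted basis -/

/-- The linear map which sends `X_i ^ k * X_i' ^ l` to `ψ k` if `l = j`, and to `0` otherwise. -/
def pairing (i i' : Fin 2) (j : ℕ) (ψ : ℕ → LaurentSeries F) :
    MvPolynomial (Fin 2) F →ₗ[F] LaurentSeries F :=
  (MvPolynomial.basisMonomials (Fin 2) F).constr F fun m => if m i' = j then ψ (m i) else 0

section Pairing

variable (i i' : Fin 2) (j : ℕ) (ψ : ℕ → LaurentSeries F)

theorem pairing_monomial (m : Fin 2 →₀ ℕ) (c : F) :
    pairing i i' j ψ (MvPolynomial.monomial m c) = c • if m i' = j then ψ (m i) else 0 := by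
  rw [← mul_one c, ← smul_eq_mul, ← MvPolynomial.smul_monomial, map_smul, smul_eq_mul, mul_one]
  congr 1
  have h := (MvPolynomial.basisMonomials (Fin 2) F).constr_basis F
    (fun m => if m i' = j then ψ (m i) else 0) m
  rwa [MvPolynomial.coe_basisMonomials] at h

variable {i i'} (L : ℕ) (s : ℕ → F) {b γ : F} {G : F[X]}

/-- By linearity this is checked on monomials, where the other variable is a spectator and the
hypothesis on ψ is the action on X_i^k. -/
theorem pairing_delta (hi : i ≠ i')
    (hψ : ∀ k, eulerEnd b (ψ k)
      = ∑ l ∈ Finset.Icc 1 L, ((l : F) * s l) • ψ (k + l) + (b * (k : F)) • ψ k)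
    (p : MvPolynomial (Fin 2) F) :
    pairing i i' j ψ (delta L s i b p) = eulerEnd b (pairing i i' j ψ p) := by
  have h : pairing i i' j ψ ∘ₗ delta L s i b = eulerEnd b ∘ₗ pairing i i' j ψ := by
    refine (MvPolynomial.basisMonomials (Fin 2) F).ext fun m => ?_
    rw [LinearMap.comp_apply, LinearMap.comp_apply, MvPolynomial.coe_basisMonomials,
      pairing_monomial, delta_apply, MvPolynomial.X_mul_pderiv_monomial, MvPolynomial.C_mul', SVar_eq, Finset.sum_mul,
      map_add, map_sum, one_smul]
    simp only [MvPolynomial.X_pow_eq_monomial, MvPolynomial.C_mul_monomial,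
      MvPolynomial.monomial_mul, mul_one, pairing_monomial, Finsupp.add_apply,
      Finsupp.single_eq_same, Finsupp.single_eq_of_ne hi.symm, zero_add,
      map_smul, map_nsmul, one_smul]
    split_ifs
    · rw [hψ, ← Nat.cast_smul_eq_nsmul F, smul_smul]
      simp only [add_comm]
    · simp
  exact LinearMap.congr_fun h p

theorem pairing_aeval_delta (hi : i ≠ i')
    (hψ : ∀ k, eulerEnd b (ψ k)
      = ∑ l ∈ Finset.Icc 1 L, ((l : F) * s l) • ψ (k + l) + (b * (k : F)) • ψ k)
    (p : MvPolynomial (Fin 2) F) :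
    pairing i i' j ψ (aeval (delta L s i b) G p)
      = aeval (eulerEnd b) G (pairing i i' j ψ p) := by
  have h (m : ℕ) : pairing i i' j ψ ((delta L s i b ^ m) p)
      = (eulerEnd b ^ m) (pairing i i' j ψ p) := by
    induction m with
    | zero => rfl
    | succ m ih =>
      rw [pow_succ', pow_succ', Module.End.mul_apply, Module.End.mul_apply,
        pairing_delta j ψ L s hi hψ, ih]
  simp only [aeval_end_apply, map_sum, map_smul, h]

theorem pairing_X_mul (hi : i ≠ i')
    (hψ : ∀ k, ψ (k + 1) = HahnSeries.single 1 γ * aeval (eulerEnd b) G (ψ k))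
    (p : MvPolynomial (Fin 2) F) :
    pairing i i' j ψ (MvPolynomial.X i * p)
      = HahnSeries.single 1 γ * aeval (eulerEnd b) G (pairing i i' j ψ p) := by
  induction p using MvPolynomial.induction_on' with
  | monomial m c =>
    rw [MvPolynomial.X, MvPolynomial.monomial_mul, pairing_monomial, pairing_monomial, map_smul,
      ← HahnSeries.C_mul_eq_smul, ← HahnSeries.C_mul_eq_smul, mul_left_comm]
    simp only [Finsupp.add_apply, Finsupp.single_eq_same, Finsupp.single_eq_of_ne hi.symm,
      zero_add, one_mul]
    split_ifs
    · rw [add_comm, hψ]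
    · simp
  | add p q hp hq => rw [mul_add, map_add, map_add, map_add, hp, hq, mul_add]

/-- The differential equation satisfied by the Christoffel-Darboux polynomial. -/
theorem eulerEnd_pairing (hi : i ≠ i') (hγ : γ ≠ 0)
    (hD : ∀ k, eulerEnd b (ψ k)
      = ∑ l ∈ Finset.Icc 1 L, ((l : F) * s l) • ψ (k + l) + (b * (k : F)) • ψ k)
    (hX : ∀ k, ψ (k + 1) = HahnSeries.single 1 γ * aeval (eulerEnd b) G (ψ k))
    (p q : MvPolynomial (Fin 2) F) :
    eulerEnd b (pairing i i' j ψ p)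
      = pairing i i' j ψ (delta L s i b p + aeval (delta L s i b) G q)
        - HahnSeries.single (-1) γ⁻¹ * pairing i i' j ψ (MvPolynomial.X i * q) := by
  -- Multiplication by X_i becomes γ x G(bD), so the subtracted term cancels the G(bD) image of q
  -- exactly.
  rw [map_add, pairing_delta j ψ L s hi hD, pairing_aeval_delta j ψ L s hi hD,
    pairing_X_mul j ψ hi hX, ← mul_assoc, HahnSeries.single_mul_single, inv_mul_cancel₀ hγ,
    neg_add_cancel, HahnSeries.single_zero_one, one_mul, add_sub_cancel_right]

end Pairing

theorem pairing_zero_one {n : ℕ} {p : MvPolynomial (Fin 2) F}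
    (hp : ∀ i, p ∈ weightLT F (expo i) n) (j : Fin n) (ψ : ℕ → LaurentSeries F) :
    pairing 0 1 j ψ p = ∑ i : Fin n, coeffXY i j p • ψ i := by
  conv_lhs => rw [← sum_coeffXY hp]
  simp only [map_sum, ← monomial_eq_C_mul, pairing_monomial]
  refine Finset.sum_congr rfl fun i _ => ?_
  rw [Finset.sum_eq_single_of_mem j (Finset.mem_univ _)]
  · simp
  · intro l _ hl
    rw [if_neg, smul_zero]
    simpa using fun e => hl (Fin.ext e)

theorem pairing_one_zero {n : ℕ} {p : MvPolynomial (Fin 2) F}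
    (hp : ∀ i, p ∈ weightLT F (expo i) n) (i : Fin n) (ψ : ℕ → LaurentSeries F) :
    pairing 1 0 i ψ p = ∑ j : Fin n, coeffXY i j p • ψ j := by
  conv_lhs => rw [← sum_coeffXY hp]
  simp only [map_sum, ← monomial_eq_C_mul, pairing_monomial]
  rw [Finset.sum_eq_single_of_mem i (Finset.mem_univ _)]
  · simp
  · intro l _ hl
    refine Finset.sum_eq_zero fun j _ => ?_
    rw [if_neg, smul_zero]
    simpa using fun e => hl (Fin.ext e)

end AdaptedBases

/-! ### Matrices which are polynomials in `1 / x` -/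

section Matrices

variable {F : Type*} [Field F] {n : ℕ}

theorem isDegreeOne_transpose {E : Matrix (Fin n) (Fin n) (LaurentSeries F)}
    (hE : IsDegreeOneInInverse E) : IsDegreeOneInInverse E.transpose := by
  obtain ⟨E₀, E₁, h1, rfl⟩ := hE
  exact ⟨E₀.transpose, E₁.transpose, by simpa using h1, rfl⟩

/-- An invertible constant factor cannot annihilate the nonzero coefficient of 1/x. -/
theorem isDegreeOne_mul {A : Matrix (Fin n) (Fin n) F} (hA : IsUnit A.det)
    {E : Matrix (Fin n) (Fin n) (LaurentSeries F)} (hE : IsDegreeOneInInverse E) :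
    IsDegreeOneInInverse ((A⁻¹).map (fun a => (HahnSeries.C a : LaurentSeries F)) * E) := by
  obtain ⟨E₀, E₁, h1, rfl⟩ := hE
  refine ⟨A⁻¹ * E₀, A⁻¹ * E₁, fun h => h1 ?_, ?_⟩
  · rw [← Matrix.mul_nonsing_inv_cancel_left A E₁ hA, h, mul_zero]
  · rw [mul_add]
    congr 1
    · exact (Matrix.map_mul (f := (HahnSeries.C : F →+* LaurentSeries F))).symm
    · ext1 i j
      simp only [Matrix.mul_apply, Matrix.map_apply]
      change _ = HahnSeries.single.addMonoidHom (-1) _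
      rw [map_sum]
      refine Finset.sum_congr rfl fun k _ => ?_
      rw [HahnSeries.C_apply, HahnSeries.single_mul_single, zero_add]
      rfl

theorem eq_inv_mul_mulVec {A : Matrix (Fin n) (Fin n) F} (hA : IsUnit A.det)
    {E : Matrix (Fin n) (Fin n) (LaurentSeries F)} {φ ψ : Fin n → LaurentSeries F}
    (h : (A.map (fun a => (HahnSeries.C a : LaurentSeries F))).mulVec φ = E.mulVec ψ) :
    φ = ((A⁻¹).map (fun a => (HahnSeries.C a : LaurentSeries F)) * E).mulVec ψ := by
  have h1 : (A⁻¹).map (fun a => (HahnSeries.C a : LaurentSeries F))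
      * A.map (fun a => (HahnSeries.C a : LaurentSeries F)) = 1 := by
    refine (Matrix.map_mul (f := (HahnSeries.C : F →+* LaurentSeries F))).symm.trans ?_
    rw [Matrix.nonsing_inv_mul A hA]
    exact Matrix.map_one _ (map_zero _) (map_one _)
  rw [← Matrix.mulVec_mulVec, ← h, Matrix.mulVec_mulVec, h1, Matrix.one_mulVec]

end Matrices

/-! ### Invertibility, degree in 1/x and the differential systems for the matrices themselves -/

section Main

variable {F : Type*} [Field F] (L : ℕ) (G : F[X]) (s : ℕ → F) (β γ : F)

theorem AMat_apply {n : ℕ} (i j : Fin n) :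
    AMat n L G s β i j = coeffXY i j (cdPoly L G s β) := by
  rw [AMat, Matrix.of_apply, AGen_eq, coeffRT_algebraMap]

theorem ETilde_apply {n : ℕ} (i j : Fin n) :
    ETilde n L G s β γ i j = HahnSeries.C (coeffXY i j (foldPoly L G s β))
      - HahnSeries.single (-1)
        (γ⁻¹ * coeffXY i j (MvPolynomial.X 0 * (MvPolynomial.X 1 * sigma L s))) := by
  rw [ETilde, Matrix.of_apply, CGen_eq, BGen_eq, coeffRT_algebraMap, coeffRT_algebraMap]

variable {G}

theorem isUnit_det_AMat [CharZero F] (hL : 1 ≤ L) (hG : 1 ≤ G.natDegree) (hG0 : G.coeff 0 = 1)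
    (hs : s L ≠ 0) : IsUnit (AMat (L * G.natDegree) L G s β).det := by
  refine isUnit_det_of_antitriangular _ ?_ ?_ ?_ ?_
  · intro i hi
    rw [AMat_apply, hi, coeffXY_zero_cdPoly, if_pos rfl, hG0]
  · intro i j hi hj
    rw [AMat_apply, hi, coeffXY_zero_cdPoly, if_neg hj]
  · intro i j hij
    rw [AMat_apply, coeffXY_cdPoly_of_gt L G s β _ _ hij]
  · intro i j hij
    obtain ⟨k, hk⟩ : ∃ k, (i : ℕ) = k + 1 := Nat.exists_eq_succ_of_ne_zero (by omega)
    obtain ⟨l, hl⟩ : ∃ l, (j : ℕ) = l + 1 := Nat.exists_eq_succ_of_ne_zero (by omega)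
    rw [hk, hl] at hij
    rw [AMat_apply, hk, hl, coeffXY_cdPoly_of_eq L G s β hL k l hij, neg_ne_zero]
    refine mul_ne_zero (leadingCoeff_ne_zero.mpr ?_) (pow_ne_zero _ (mul_ne_zero ?_ hs))
    · rintro rfl
      simp at hG
    · exact Nat.cast_ne_zero.mpr (by omega)

/-- The coefficient of r^L in S(r) - S(t) is L s_L. This is what makes the degree in 1/x exactly
one. -/
theorem sigma_ne_zero [CharZero F] (hL : 1 ≤ L) (hs : s L ≠ 0) : sigma L s ≠ 0 := by
  intro h
  have h1 := sigma_mul L s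
  rw [h, zero_mul, eq_comm, sub_eq_zero] at h1
  have h2 := congrArg (coeffXY L 0) h1
  have e (k : ℕ) (c : F) := coeffXY_C_mul_X_pow L 0 k 0 c
  have e' (k : ℕ) (c : F) := coeffXY_C_mul_X_pow L 0 0 k c
  simp only [pow_zero, mul_one, one_mul, and_true] at e e'
  rw [SVar_eq, SVar_eq, map_sum, map_sum] at h2
  simp only [e, e'] at h2
  rw [Finset.sum_ite_eq, if_pos (Finset.mem_Icc.mpr ⟨hL, le_rfl⟩), Finset.sum_eq_zero] at h2
  · exact mul_ne_zero (Nat.cast_ne_zero.mpr (by omega)) hs h2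
  · intro k _
    rw [if_neg (by omega)]

theorem isDegreeOne_ETilde [CharZero F] (hL : 1 ≤ L) (hG : 2 ≤ G.natDegree) (hs : s L ≠ 0)
    (hγ : γ ≠ 0) : IsDegreeOneInInverse (ETilde (L * G.natDegree) L G s β γ) := by
  refine ⟨Matrix.of fun i j => coeffXY i j (foldPoly L G s β), Matrix.of fun i j =>
    -(γ⁻¹ * coeffXY i j (MvPolynomial.X 0 * (MvPolynomial.X 1 * sigma L s))), fun h => ?_, ?_⟩
  · have h1 := sum_coeffXY (X_mul_X_mul_sigma_mem_weightLT L s hL hG)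
    rw [Finset.sum_eq_zero, eq_comm] at h1
    · exact mul_ne_zero (MvPolynomial.X_ne_zero 0) (mul_ne_zero (MvPolynomial.X_ne_zero 1)
        (sigma_ne_zero L s hL hs)) h1
    · intro i _
      refine Finset.sum_eq_zero fun j _ => ?_
      have h2 := congrFun (congrFun h i) j
      rw [Matrix.of_apply, Matrix.zero_apply, neg_eq_zero] at h2
      rw [(mul_eq_zero.mp h2).resolve_left (inv_ne_zero hγ), map_zero, zero_mul]
  · ext1 i j
    rw [ETilde_apply, Matrix.add_apply, Matrix.map_apply, Matrix.map_apply, Matrix.of_apply,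
      Matrix.of_apply, HahnSeries.single_neg, sub_eq_add_neg]

theorem sum_AMat (hL : 1 ≤ L) (hG : 1 ≤ G.natDegree) :
    ∑ i : Fin (L * G.natDegree), ∑ j : Fin (L * G.natDegree),
      algebraMap F (RatRT F) (AMat (L * G.natDegree) L G s β i j)
        * rVar F ^ (i : ℕ) * tVar F ^ (j : ℕ) = AGen L G s β := by
  rw [AGen_eq, ← sum_coeffXY_RatRT (cdPoly_mem_weightLT L s β hL hG)]
  simp only [AMat_apply, mul_assoc]

theorem sum_ETilde (hL : 1 ≤ L) (hG : 2 ≤ G.natDegree) :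
    ∑ i : Fin (L * G.natDegree), ∑ j : Fin (L * G.natDegree),
      HahnSeries.map (ETilde (L * G.natDegree) L G s β γ i j) (algebraMap F (RatRT F))
        * HahnSeries.C (rVar F ^ (i : ℕ) * tVar F ^ (j : ℕ)) = EGen L G s β γ := by
  ext m
  simp only [HahnSeries.coeff_sum]
  rw [EGen, CGen_eq, BGen_eq, ← sum_coeffXY_RatRT (foldPoly_mem_weightLT L s β hL hG),
    ← sum_coeffXY_RatRT (X_mul_X_mul_sigma_mem_weightLT L s hL hG)]
  simp only [HahnSeries.C_apply, HahnSeries.coeff_mul_single_zero, HahnSeries.map_coeff,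
    ETilde_apply, HahnSeries.coeff_sub, map_sub, HahnSeries.coeff_single, sub_mul,
    Finset.sum_sub_distrib]
  congr 1
  · split_ifs <;> simp
  · split_ifs
    · simp only [Finset.mul_sum, map_mul, Algebra.smul_def, mul_assoc]
    · simp

theorem coeff_mul_single_sub (c d : F) (f : LaurentSeries F) :
    (HahnSeries.C c - HahnSeries.single (-1) (γ⁻¹ * d)) * f
      = c • f - HahnSeries.single (-1) γ⁻¹ * (d • f) := by
  rw [← HahnSeries.C_mul_eq_smul, ← HahnSeries.C_mul_eq_smul, ← mul_assoc, HahnSeries.C_apply d,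
    HahnSeries.single_mul_single, add_zero, sub_mul]

/-- `eulerEnd_pairing` with p the Christoffel-Darboux polynomial and q = t σ: the combination
appearing there is `foldPoly` by definition. Fixing the exponent j of t selects column j, whence the
transposes. -/
theorem AMat_transpose_mulVec (hL : 1 ≤ L) (hG : 2 ≤ G.natDegree) (hγ : γ ≠ 0)
    (ψ : ℕ → LaurentSeries F)
    (hD : ∀ k, eulerEnd β (ψ k)
      = ∑ l ∈ Finset.Icc 1 L, ((l : F) * s l) • ψ (k + l) + (β * (k : F)) • ψ k)
    (hX : ∀ k, ψ (k + 1) = HahnSeries.single 1 γ * aeval (eulerEnd β) G (ψ k)) :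
    ((AMat (L * G.natDegree) L G s β).transpose.map
        (fun a => (HahnSeries.C a : LaurentSeries F))).mulVec (fun i => eulerEnd β (ψ i))
      = (ETilde (L * G.natDegree) L G s β γ).transpose.mulVec (fun i => ψ i) := by
  funext j
  have h := eulerEnd_pairing (i := 0) (i' := 1) j ψ L s (by decide) hγ hD hX (cdPoly L G s β)
    (MvPolynomial.X 1 * sigma L s)
  change _ = pairing 0 1 j ψ (foldPoly L G s β) - _ at h
  rw [pairing_zero_one (cdPoly_mem_weightLT L s β hL (by omega)),
    pairing_zero_one (foldPoly_mem_weightLT L s β hL hG),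
    pairing_zero_one (X_mul_X_mul_sigma_mem_weightLT L s hL hG), map_sum, Finset.mul_sum,
    ← Finset.sum_sub_distrib] at h
  simp only [Matrix.mulVec, dotProduct, Matrix.map_apply, Matrix.transpose_apply, AMat_apply,
    ETilde_apply, coeff_mul_single_sub, HahnSeries.C_mul_eq_smul]
  simpa only [map_smul] using h

/-- The mirror case: t is paired with ψ and r is frozen, with q = r σ and the form of the folded
polynomial given by `foldPoly_eq'`. -/
theorem AMat_mulVec (hL : 1 ≤ L) (hG : 2 ≤ G.natDegree) (hγ : γ ≠ 0)
    (ψ : ℕ → LaurentSeries F)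
    (hD : ∀ k, eulerEnd (-β) (ψ k)
      = ∑ l ∈ Finset.Icc 1 L, ((l : F) * s l) • ψ (k + l) + (-β * (k : F)) • ψ k)
    (hX : ∀ k, ψ (k + 1) = HahnSeries.single 1 γ * aeval (eulerEnd (-β)) G (ψ k)) :
    ((AMat (L * G.natDegree) L G s β).map
        (fun a => (HahnSeries.C a : LaurentSeries F))).mulVec (fun i => eulerEnd (-β) (ψ i))
      = (ETilde (L * G.natDegree) L G s β γ).mulVec (fun i => ψ i) := by
  funext i
  have h := eulerEnd_pairing (i := 1) (i' := 0) i ψ L s (by decide) hγ hD hX (cdPoly L G s β)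
    (MvPolynomial.X 0 * sigma L s)
  rw [← foldPoly_eq', mul_left_comm, pairing_one_zero (cdPoly_mem_weightLT L s β hL (by omega)),
    pairing_one_zero (foldPoly_mem_weightLT L s β hL hG),
    pairing_one_zero (X_mul_X_mul_sigma_mem_weightLT L s hL hG), map_sum, Finset.mul_sum,
    ← Finset.sum_sub_distrib] at h
  simp only [Matrix.mulVec, dotProduct, Matrix.map_apply, AMat_apply,
    ETilde_apply, coeff_mul_single_sub, HahnSeries.C_mul_eq_smul]
  simpa only [map_smul] using h

theorem rho_ofNat (n : ℕ) :
    rho G β γ (n : ℤ) = γ ^ n * ∏ i ∈ Finset.Icc 1 n, G.eval ((i : F) * β) :=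
  rfl

theorem rho_natCast_eq (hG0 : G.coeff 0 = 1) (hγ : γ ≠ 0) (n : ℕ) :
    rho G β γ n = γ * G.eval ((n : F) * β) * rho G β γ (n - 1) := by
  rcases n with _ | n
  -- At n = 0 the recursion crosses into negative indices, ρ_{-1} = γ⁻¹ G(0)⁻¹, and G(0) = 1 is
  -- used.
  · change γ ^ 0 * _ = _ * rho G β γ (Int.negSucc 0)
    simp [rho, ← coeff_zero_eq_eval_zero, hG0, hγ]
  · rw [show ((n + 1 : ℕ) : ℤ) - 1 = (n : ℕ) by push_cast; ring, rho_ofNat, rho_ofNat,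
      Finset.prod_Icc_succ_top (by omega)]
    ring

/-- Since the inverse of 0 is 0, inverting twice is harmless even when some G(-iβ) vanishes; no
nonvanishing assumption is needed. -/
theorem inv_rho_neg (n : ℕ) :
    (rho G β γ (-(n : ℤ)))⁻¹ = γ ^ n * ∏ i ∈ Finset.range n, G.eval (-(i : F) * β) := by
  rcases n with _ | n
  · change (γ ^ 0 * _)⁻¹ = _
    simp
  · rw [show (-((n + 1 : ℕ) : ℤ)) = Int.negSucc n from rfl]
    simp [rho, mul_comm]

theorem PsiMinus_eq_adapted [CharZero F] (k : ℕ) :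
    PsiMinus L G s β γ k = adapted L s (-β) (fun n => (rho G β γ (-n))⁻¹) k := by
  rw [adapted, inv_neg]
  rfl

end Main

end

end WeightedHurwitz

theorem mainTheorem7 {F : Type*} [Field F] [CharZero F] (L M : ℕ) (hL : 1 ≤ L) (hM : 2 ≤ M)
    (G : F[X]) (hG0 : G.coeff 0 = 1) (hGM : G.natDegree = M)
    (s : ℕ → F) (hs : s L ≠ 0) (β γ : F) (hβ : β ≠ 0) (hγ : γ ≠ 0) :
    -- the Christoffel-Darboux matrix: generating function and invertibility
    (∑ i : Fin (L * M), ∑ j : Fin (L * M),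
        algebraMap F (WeightedHurwitz.RatRT F) (WeightedHurwitz.AMat (L * M) L G s β i j)
          * WeightedHurwitz.rVar F ^ (i : ℕ) * WeightedHurwitz.tVar F ^ (j : ℕ)
      = WeightedHurwitz.AGen L G s β) ∧
    IsUnit (WeightedHurwitz.AMat (L * M) L G s β).det ∧
    -- the generating function of the entries of `Ẽ(x)`
    (∑ i : Fin (L * M), ∑ j : Fin (L * M),
        HahnSeries.map (WeightedHurwitz.ETilde (L * M) L G s β γ i j)
            (algebraMap F (WeightedHurwitz.RatRT F))
          * HahnSeries.C (WeightedHurwitz.rVar F ^ (i : ℕ) * WeightedHurwitz.tVar F ^ (j : ℕ))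
      = WeightedHurwitz.EGen L G s β γ) ∧
    -- `Ẽ(x)` and `E^±(x)` are first degree polynomials in `1 / x`
    WeightedHurwitz.IsDegreeOneInInverse (WeightedHurwitz.ETilde (L * M) L G s β γ) ∧
    WeightedHurwitz.IsDegreeOneInInverse (WeightedHurwitz.EPlus (L * M) L G s β γ) ∧
    WeightedHurwitz.IsDegreeOneInInverse (WeightedHurwitz.EMinus (L * M) L G s β γ) ∧
    -- the differential systems `± β D Ψ^± = E^±(x) Ψ^±`
    (fun i : Fin (L * M) =>
        β • WeightedHurwitz.eulerD (WeightedHurwitz.PsiPlus L G s β γ ((i : ℕ) : ℤ)))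
      = (WeightedHurwitz.EPlus (L * M) L G s β γ).mulVec
          (fun j : Fin (L * M) => WeightedHurwitz.PsiPlus L G s β γ ((j : ℕ) : ℤ)) ∧
    (fun i : Fin (L * M) =>
        -(β • WeightedHurwitz.eulerD (WeightedHurwitz.PsiMinus L G s β γ ((i : ℕ) : ℤ))))
      = (WeightedHurwitz.EMinus (L * M) L G s β γ).mulVec
          (fun j : Fin (L * M) => WeightedHurwitz.PsiMinus L G s β γ ((j : ℕ) : ℤ)) := by
  subst hGM
  have hM1 : 1 ≤ G.natDegree := by omega
  have hdet := WeightedHurwitz.isUnit_det_AMat L s β hL hM1 hG0 hs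
  have hdet' : IsUnit (WeightedHurwitz.AMat (L * G.natDegree) L G s β).transpose.det := by
    rwa [Matrix.det_transpose]
  have hE := WeightedHurwitz.isDegreeOne_ETilde L s β γ hL hM hs hγ
  refine ⟨WeightedHurwitz.sum_AMat L s β hL hM1, hdet, WeightedHurwitz.sum_ETilde L s β γ hL hM,
    hE, WeightedHurwitz.isDegreeOne_mul hdet' (WeightedHurwitz.isDegreeOne_transpose hE),
    WeightedHurwitz.isDegreeOne_mul hdet hE, ?_, ?_⟩
  · refine WeightedHurwitz.eq_inv_mul_mulVec hdet' ?_
    refine WeightedHurwitz.AMat_transpose_mulVec L s β γ hL hM hγ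
      (fun k => WeightedHurwitz.PsiPlus L G s β γ k) (fun k => ?_) (fun k => ?_)
    -- Ψ⁺ is definitionally an adapted basis with b = β and w n = γ ρ_{n-1}.
    · exact WeightedHurwitz.eulerEnd_adapted L s hβ _ k
    · refine WeightedHurwitz.adapted_succ L s (fun n => ?_) k
      rw [add_sub_cancel_right, WeightedHurwitz.rho_natCast_eq β γ hG0 hγ]
      ring
  · have key := WeightedHurwitz.AMat_mulVec L s β γ hL hM hγ
      (fun k => WeightedHurwitz.PsiMinus L G s β γ k) (fun k => ?_) (fun k => ?_)
    · refine (funext fun i => ?_ : _ = _).trans (WeightedHurwitz.eq_inv_mul_mulVec hdet key)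
      rw [WeightedHurwitz.eulerEnd_apply, neg_smul]
    · simp only [WeightedHurwitz.PsiMinus_eq_adapted]
      exact WeightedHurwitz.eulerEnd_adapted L s (neg_ne_zero.mpr hβ) _ k
    · simp only [WeightedHurwitz.PsiMinus_eq_adapted]
      -- Here b = -β and w n = ρ_{-n}⁻¹, so the recursion adds the factor γ G(-nβ), the last one in
      -- the product for n + 1.
      refine WeightedHurwitz.adapted_succ L s (fun n => ?_) k
      have h := WeightedHurwitz.inv_rho_neg (G := G) β γ (n + 1)
      push_cast at h
      rw [h, WeightedHurwitz.inv_rho_neg, Finset.prod_range_succ, neg_mul_comm]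
      ring
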